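/- A word over an alphabet $\Sigma$ is square-free if it has no factor of the form $xx$ with $x$ a nonempty word. The circular word formed from a word $w$, denoted $[w]$, is the set of all conjugates (cyclic shifts) of $w$, and its length is the length of $w$. It is square-free if every conjugate of $w$ is square-free, and it contains a square otherwise. An extension of $[w]$ is a circular word of the form $[w'aw'']$, where $a\in\Sigma$ is a letter and $w=w'w''$ (with $w',w''$ possibly empty; the set of extensions does not depend on the chosen representative $w$). The circular word $[w]$ is extremal square-free if it is square-free and every extension of it contains a square. Theorem. Let $n$ be a nonnegative integer. There is an extremal square-free circular word of length $n$ over a three-letter alphabet $\{\mathtt a,\mathtt b,\mathtt c\}$ if and only if $$n\in\{4,6,8,13,15,16,18,20,21,22,23,24,28,30,32,33,34,35,36\}\cup\{m : m\ge 38\}.$$ -/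

import Mathlib

namespace CircularWords

variable {α : Type*}

/-- A word is square-free if it has no factor of the form `x ++ x` with `x` nonempty. -/
def SquareFree (w : List α) : Prop :=
  ∀ x : List α, x ≠ [] → ¬ (x ++ x) <:+: w

/-- A circular word (a word up to cyclic shift, that is, a conjugacy class of words)
is square-free if each of its representatives is square-free. -/
def CircularSquareFree (c : Cycle α) : Prop :=
  ∀ w : List α, (w : Cycle α) = c → SquareFree w

/-- `d` is an extension of the circular word `c`: it arises by inserting one letter, at any
position, into a representative of `c`. -/
def IsExtension (c d : Cycle α) : Prop :=
  ∃ (u v : List α) (a : α),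
    ((u ++ v : List α) : Cycle α) = c ∧ ((u ++ a :: v : List α) : Cycle α) = d

/-- A circular word is extremal square-free if it is square-free and each of its extensions
contains a square. -/
def ExtremalSquareFree (c : Cycle α) : Prop :=
  CircularSquareFree c ∧ ∀ d : Cycle α, IsExtension c d → ¬ CircularSquareFree d

end CircularWords

/-! Nonexistence is a finite search. Lengths 0 and 1 are immediate, and the other excluded lengths
are at most 37. A backtracking search prolongs a word to the left, drops it as soon as it has a
square prefix, and tests every survivor of excluded length for extremality. Permuting letters, the
word may be assumed to end in 01. To keep the search small, words containing 2120210 up to renaming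
are treated separately: rotation and renaming move this pattern to the end, so one search starts
from these seven letters (`search_pattern`) and the other drops every word that begins with such a
pattern (`search_avoiding`).

Existence below length 150 is by explicit words. From 150 on, blocks are substituted for the letters
of a square-free circular word of length k. Every block starts with the marker 010210, which has no
other occurrence in a product of blocks. A square whose first half contains no marker lies in two
adjacent blocks followed by a marker, and is excluded by inspection. In any other square the markers
force the period to carry block boundaries to block boundaries; since blocks of different classes
have short common prefixes and suffixes, the classes themselves then contain a square
(`Factorization.not_squareAt`). Extremality is local: inserting a letter anywhere in a product of
blocks creates a square within distance 11 of the insertion (`closedGaps_blocks`,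
`extremalSquareFree_flatten`).

The letters 0 and 1 have one block of length 43 each, while 2 has blocks of many lengths: sums of
two fill 64 to 150, sums of three fill 90 to 225. So a class word of length k with three letters 2
yields all lengths from 43k - 39 to 43k + 96, and these intervals overlap for consecutive k. The
words so obtained are themselves square-free and serve as class words for larger lengths, which
closes a strong induction (`exists_extremalSquareFree_of_ge`, `exists_circularSquareFree`). -/

namespace CircularWords

variable {α : Type*}

/-! ### Circular square-freeness through periodic words, and its symmetries -/

/-- The letter at position `i` of the infinite periodic word `w w w ⋯`. -/
def periodic [Inhabited α] (w : List α) (i : ℕ) : α := w.getD (i % w.length) default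

/-- The infinite word `f` has a square of period `p` at position `i`. -/
def SquareAt (f : ℕ → α) (i p : ℕ) : Prop := ∀ j < p, f (i + j) = f (i + p + j)

section
variable [Inhabited α]

theorem periodic_add_length (w : List α) (i : ℕ) :
    periodic w (i + w.length) = periodic w i := by
  simp [periodic]

theorem periodic_of_lt {w : List α} {i : ℕ} (h : i < w.length) :
    periodic w i = w[i] := by
  simp [periodic, Nat.mod_eq_of_lt h, h]

theorem periodic_mod (w : List α) (i : ℕ) : periodic w (i % w.length) = periodic w i := by
  simp [periodic]

theorem periodic_rotate (w : List α) (r j : ℕ) :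
    periodic (w.rotate r) j = periodic w (r + j) := by
  rcases Nat.eq_zero_or_pos w.length with h | h
  · simp [List.length_eq_zero_iff.1 h, periodic]
  · have h' := Nat.mod_lt j h
    simp only [periodic, List.length_rotate, List.getD_eq_getElem?_getD]
    rw [List.getElem?_rotate h', Nat.mod_add_mod, Nat.add_comm]

/-- A factor of a conjugate is a factor of www⋯ of length at most that of w. The bound on 2p cannot
be dropped, since www⋯ always has squares of period `w.length`. -/
theorem circularSquareFree_coe_iff (w : List α) :
    CircularSquareFree (w : Cycle α) ↔
      ∀ i p, 0 < p → 2 * p ≤ w.length → ¬ SquareAt (periodic w) i p := by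
  constructor
  · intro h i p hp hn hs
    have hl : (w.rotate i).length = w.length := List.length_rotate ..
    refine h (w.rotate i) (Cycle.coe_eq_coe.2 (List.IsRotated.symm ⟨i, rfl⟩))
      ((w.rotate i).take p) ?_ ?_
    · intro h0
      have := congrArg List.length h0
      simp only [List.length_take, List.length_nil] at this
      omega
    · have key : ((w.rotate i).drop p).take p = (w.rotate i).take p := by
        apply List.ext_getElem
        · simp only [List.length_take, List.length_drop]; omega
        · intro j h1 h2
          have hj : j < p := by simp at h2; omega
          rw [List.getElem_take, List.getElem_take, List.getElem_drop,
            ← periodic_of_lt, ← periodic_of_lt, periodic_rotate, periodic_rotate, ← add_assoc]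
          exact (hs j hj).symm
      have : (w.rotate i).take p ++ (w.rotate i).take p = (w.rotate i).take (p + p) := by
        rw [List.take_add, key]
      rw [this]
      exact (List.take_prefix _ _).isInfix
  · rintro h v hv x hx ⟨s, t, rfl⟩
    obtain ⟨r, hr⟩ := (Cycle.coe_eq_coe.1 hv).symm
    have hlen : w.length = (s ++ (x ++ x) ++ t).length := by rw [← hr, List.length_rotate]
    have hxl : 0 < x.length := List.length_pos_iff.2 hx
    refine h (r + s.length) x.length hxl (by simp at hlen; omega) ?_
    intro j hj
    have e : ∀ k, k < x.length + x.length →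
        periodic w (r + s.length + k) = (x ++ x).getD k default := by
      intro k hk
      rw [add_assoc, ← periodic_rotate, hr, periodic_of_lt (by simp; omega)]
      simp [List.getElem_append, hk]
      split_ifs <;> simp_all
      omega
    rw [e j (by omega), add_assoc _ x.length, e _ (by omega)]
    simp [List.getElem?_append, hj]

end

/-- A conjugate of the extension has the inserted letter in front, so only a rotation and a letter
need to be quantified over. -/
theorem extremalSquareFree_coe_iff (w : List α) :
    ExtremalSquareFree (w : Cycle α) ↔ CircularSquareFree (w : Cycle α) ∧
      ∀ g a, ¬ CircularSquareFree ((a :: w.rotate g : List α) : Cycle α) := by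
  refine and_congr_right fun _ => ⟨fun h g a => ?_, ?_⟩
  · exact h _ ⟨[], w.rotate g, a, Cycle.coe_eq_coe.2 (List.IsRotated.symm ⟨g, rfl⟩), rfl⟩
  · rintro h d ⟨u, v, a, huv, rfl⟩
    have h1 : (w : List α) ~r (v ++ u) :=
      (Cycle.coe_eq_coe.1 huv).symm.trans List.isRotated_append
    obtain ⟨g, hg⟩ := h1
    have h2 : ((u ++ a :: v : List α) : Cycle α) = ((a :: w.rotate g : List α) : Cycle α) := by
      rw [hg]
      exact Cycle.coe_eq_coe.2 List.isRotated_append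
    rw [h2]
    exact h g a

theorem squareFree_map_iff {β : Type*} {f : α → β} (hf : f.Injective) (w : List α) :
    SquareFree (w.map f) ↔ SquareFree w := by
  constructor
  · intro h x hx hi
    refine h (x.map f) (by simpa using hx) ?_
    simpa using hi.map f
  · rintro h x hx ⟨s, t, e⟩
    obtain ⟨y, t', hy, h1, rfl⟩ := List.map_eq_append_iff.1 e.symm
    obtain ⟨s', y', rfl, rfl, h2⟩ := List.map_eq_append_iff.1 h1
    obtain ⟨x1, x2, rfl, h3, h4⟩ := List.map_eq_append_iff.1 h2
    have : x1 = x2 := (List.map_injective_iff.2 hf) (h3.trans h4.symm)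
    subst this
    refine h x1 ?_ (by rw [hy]; exact ⟨s', t', rfl⟩)
    rintro rfl
    exact hx (by simpa using h3.symm)

theorem circularSquareFree_map_iff {f : α → α} (hf : f.Injective) (w : List α) :
    CircularSquareFree ((w.map f : List α) : Cycle α) ↔ CircularSquareFree (w : Cycle α) := by
  constructor
  · intro h v hv
    rw [← squareFree_map_iff hf]
    exact h _ (Cycle.coe_eq_coe.2 ((Cycle.coe_eq_coe.1 hv).map f))
  · intro h v hv
    obtain ⟨r, hr⟩ := (Cycle.coe_eq_coe.1 hv).symm
    rw [← hr, ← List.map_rotate, squareFree_map_iff hf]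
    exact h _ (Cycle.coe_eq_coe.2 (List.IsRotated.symm ⟨r, rfl⟩))

theorem extremalSquareFree_map (σ : Equiv.Perm α) {w : List α}
    (h : ExtremalSquareFree (w : Cycle α)) :
    ExtremalSquareFree ((w.map σ : List α) : Cycle α) := by
  rw [extremalSquareFree_coe_iff] at h ⊢
  refine ⟨(circularSquareFree_map_iff σ.injective w).2 h.1, fun g a hc => ?_⟩
  refine h.2 g (σ.symm a) ((circularSquareFree_map_iff σ.injective _).1 ?_)
  simpa [List.map_rotate] using hc


/-! ### Words as base-four numbers: square tests by bit operations -/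

/-- The `i`-th base-four digit of `v`. -/
def digit (v i : ℕ) : ℕ := v / 4 ^ i % 4

/-- The number whose base-four digits, from the lowest one on, are the letters of a word. -/
def code : List (Fin 3) → ℕ
  | [] => 0
  | a :: w => a.val + 4 * code w

theorem code_append (u v : List (Fin 3)) : code (u ++ v) = code u + 4 ^ u.length * code v := by
  induction u with
  | nil => simp [code]
  | cons a u ih => simp only [List.cons_append, code, ih, List.length_cons]; ring

theorem code_lt (w : List (Fin 3)) : code w < 4 ^ w.length := by
  induction w with
  | nil => simp [code]
  | cons a w ih => simp only [code, List.length_cons, pow_succ]; omega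

theorem code_div (w : List (Fin 3)) (g : ℕ) : code w / 4 ^ g = code (w.drop g) := by
  induction g generalizing w with
  | zero => simp
  | succ g ih =>
    cases w with
    | nil => simp [code]
    | cons a w =>
      rw [List.drop_succ_cons, ← ih, pow_succ', ← Nat.div_div_eq_div_mul]
      congr 1
      simp only [code]
      omega

theorem code_mod {w : List (Fin 3)} {g : ℕ} (hg : g ≤ w.length) :
    code w % 4 ^ g = code (w.take g) := by
  have h := code_append (w.take g) (w.drop g)
  have hl : (w.take g).length = g := by simpa using hg
  have := code_lt (w.take g)
  rw [List.take_append_drop, hl] at h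
  rw [hl] at this
  rw [h, Nat.add_mul_mod_self_left, Nat.mod_eq_of_lt this]

theorem digit_code {w : List (Fin 3)} {i : ℕ} (h : i < w.length) :
    digit (code w) i = (w[i]).val := by
  rw [digit, code_div, List.drop_eq_getElem_cons h, code]
  have := (w[i]).isLt
  omega

theorem digit_code_append_self {w : List (Fin 3)} {i : ℕ} (h : i < 2 * w.length) :
    digit (code w + 4 ^ w.length * code w) i = (periodic w i).val := by
  rw [← code_append, digit_code (by simp; omega)]
  congr 1
  rw [List.getElem_append]
  split_ifs with hi
  · rw [periodic_of_lt hi]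
  · have h' : i - w.length < w.length := by omega
    rw [← periodic_of_lt h', ← periodic_add_length, Nat.sub_add_cancel (by omega)]

/-- The `i`-th digits of `v` and `v'` agree if and only if their bits do. -/
theorem digit_eq_digit_iff (v v' i j : ℕ) : digit v i = digit v' j ↔
    v.testBit (2 * i) = v'.testBit (2 * j) ∧ v.testBit (2 * i + 1) = v'.testBit (2 * j + 1) := by
  have key : ∀ v i, digit v i = (v.testBit (2 * i)).toNat + 2 * (v.testBit (2 * i + 1)).toNat := by
    intro v i
    simp only [Nat.testBit_eq_decide_div_mod_eq, digit, pow_succ, pow_mul,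
      ← Nat.div_div_eq_div_mul]
    norm_num
    generalize v / 4 ^ i = x
    have h1 := Nat.mod_two_eq_zero_or_one x
    have h2 := Nat.mod_two_eq_zero_or_one (x / 2)
    rcases h1 with h1 | h1 <;> rcases h2 with h2 | h2 <;> simp [h1, h2] <;> omega
  rw [key, key]
  cases v.testBit (2 * i) <;> cases v'.testBit (2 * j) <;> cases v.testBit (2 * i + 1) <;>
    cases v'.testBit (2 * j + 1) <;> simp

/-- The even bit `2 * i` tells whether the digits `i` and `i + p` of `v` differ. -/
def mismatch (v p : ℕ) : ℕ :=
  (v ^^^ (v >>> (2 * p))) ||| ((v ^^^ (v >>> (2 * p))) >>> 1)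

theorem testBit_mismatch (v p i : ℕ) :
    (mismatch v p).testBit (2 * i) = true ↔ digit v i ≠ digit v (i + p) := by
  rw [Ne, digit_eq_digit_iff]
  simp only [mismatch, Nat.testBit_or, Nat.testBit_xor, Nat.testBit_shiftRight]
  have e1 : 2 * p + 2 * i = 2 * (i + p) := by ring
  have e2 : 2 * p + (1 + 2 * i) = 2 * (i + p) + 1 := by ring
  rw [e1, e2, Nat.add_comm 1 (2 * i)]
  cases v.testBit (2 * i) <;> cases v.testBit (2 * (i + p)) <;> cases v.testBit (2 * i + 1) <;>
    cases v.testBit (2 * (i + p) + 1) <;> simp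

/-- If the even bits of `s` are the disjunctions over windows of length `c` of those of some
number, then those of `smear f p s c` are the disjunctions over windows of length `p`. -/
def smear : ℕ → ℕ → ℕ → ℕ → ℕ
  | 0, _, s, _ => s
  | f + 1, p, s, c => bif Nat.ble (2 * c) p then smear f p (s ||| (s >>> (2 * c))) (2 * c)
      else s ||| (s >>> (2 * (p - c)))

/-- The windows of length c at i and at i + d together form one window of length c + d; `d ≤ c`
leaves no hole between them. -/
theorem testBit_or_shiftRight {e s c d : ℕ} (hd : d ≤ c)
    (hs : ∀ i, s.testBit (2 * i) = true ↔ ∃ j < c, e.testBit (2 * (i + j)) = true) (i : ℕ) :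
    (s ||| (s >>> (2 * d))).testBit (2 * i) = true ↔
      ∃ j < c + d, e.testBit (2 * (i + j)) = true := by
  have e1 : 2 * d + 2 * i = 2 * (i + d) := by ring
  rw [Nat.testBit_or, Nat.testBit_shiftRight, Bool.or_eq_true, e1, hs, hs]
  constructor
  · rintro (⟨j, hj, h⟩ | ⟨j, hj, h⟩)
    · exact ⟨j, by omega, h⟩
    · exact ⟨d + j, by omega, by rwa [← add_assoc]⟩
  · rintro ⟨j, hj, h⟩
    by_cases hjc : j < c
    · exact Or.inl ⟨j, hjc, h⟩
    · refine Or.inr ⟨j - d, by omega, ?_⟩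
      rwa [add_assoc, Nat.add_sub_cancel' (by omega)]

/-- The window doubles while it fits into p, and one last shift by p - c completes it. The fuel f
suffices because c grows at every step. Hence a test for one period costs only logarithmically many
operations on large numbers. -/
theorem testBit_smear {e : ℕ} (f p s c : ℕ) (hc : 0 < c) (hcp : c ≤ p) (hf : p ≤ c + f)
    (hs : ∀ i, s.testBit (2 * i) = true ↔ ∃ j < c, e.testBit (2 * (i + j)) = true) (i : ℕ) :
    (smear f p s c).testBit (2 * i) = true ↔ ∃ j < p, e.testBit (2 * (i + j)) = true := by
  induction f generalizing s c with
  | zero =>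
    obtain rfl : c = p := by omega
    exact hs i
  | succ f ih =>
    rw [smear]
    cases h : Nat.ble (2 * c) p with
    | true =>
      have h' := Nat.le_of_ble_eq_true h
      refine ih _ (2 * c) (by omega) h' (by omega) fun i => ?_
      rw [testBit_or_shiftRight le_rfl hs i, two_mul]
    | false =>
      have h' : ¬ 2 * c ≤ p := fun hh => by simp [Nat.ble_eq_true_of_le hh] at h
      have := testBit_or_shiftRight (d := p - c) (by omega) hs i
      rw [Nat.add_sub_cancel' hcp] at this
      exact this

/-- The number with `c` base-four digits, all of them equal to one. -/
def ones (c : ℕ) : ℕ := (4 ^ c - 1) / 3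

theorem ones_succ (c : ℕ) : ones (c + 1) = 4 * ones c + 1 := by
  have h3 : 3 ∣ 4 ^ c - 1 := by simpa using Nat.sub_dvd_pow_sub_pow 4 1 c
  have hp : 0 < 4 ^ c := by positivity
  rw [ones, ones, pow_succ]
  omega

theorem testBit_ones (c i : ℕ) : (ones c).testBit i = true ↔ i % 2 = 0 ∧ i < 2 * c := by
  induction c generalizing i with
  | zero => simp [ones]
  | succ c ih =>
    rw [ones_succ]
    match i with
    | 0 => simp [Nat.testBit_zero]; omega
    | 1 =>
      rw [Nat.testBit_succ, show (4 * ones c + 1) / 2 = 2 * ones c by omega]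
      simp [Nat.testBit_zero]
    | i + 2 =>
      rw [Nat.testBit_succ, Nat.testBit_succ, show (4 * ones c + 1) / 2 / 2 = ones c by omega, ih]
      omega

/-- No square of period `p` starts at one of the first `c` digits of `v`. -/
def noSquare (v c p : ℕ) : Bool :=
  Nat.beq (Nat.land (smear p p (mismatch v p) 1) (ones c)) (ones c)

theorem noSquare_iff {v c p : ℕ} (hp : 0 < p) : noSquare v c p = true ↔
    ∀ i < c, ∃ j < p, digit v (i + j) ≠ digit v (i + p + j) := by
  have hs := testBit_smear (e := mismatch v p) p p (mismatch v p) 1 one_pos hp (by omega)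
    (fun i => by simp)
  have hs' : ∀ i, (smear p p (mismatch v p) 1).testBit (2 * i) = true ↔
      ∃ j < p, digit v (i + j) ≠ digit v (i + p + j) := by
    intro i
    rw [hs]
    simp only [testBit_mismatch, add_right_comm i p]
  simp only [← hs']
  rw [noSquare, Nat.beq_eq]
  constructor
  · intro h i hi
    have := congrArg (fun x => x.testBit (2 * i)) h
    have h1 : (ones c).testBit (2 * i) = true := (testBit_ones _ _).2 (by omega)
    have h2 : ((smear p p (mismatch v p) 1) &&& (ones c)).testBit (2 * i)
      = (ones c).testBit (2 * i) := this
    rw [Nat.testBit_and, h1] at h2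
    simpa using h2
  · intro h
    apply Nat.eq_of_testBit_eq
    intro i
    change ((smear p p (mismatch v p) 1) &&& (ones c)).testBit i = _
    rw [Nat.testBit_and]
    cases h1 : (ones c).testBit i with
    | false => simp
    | true =>
      obtain ⟨h2, h3⟩ := (testBit_ones _ _).1 h1
      obtain ⟨k, rfl⟩ : ∃ k, i = 2 * k := ⟨i / 2, by omega⟩
      simp [h k (by omega)]

/-- No square whose period is one of the `k` numbers from `p` on starts at one of the first
`c` digits of `v`. -/
def noSquares (v c : ℕ) : ℕ → ℕ → Bool
  | 0, _ => true
  | k + 1, p => noSquare v c p && noSquares v c k (p + 1)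

theorem noSquares_iff {v c k p : ℕ} (hp : 0 < p) : noSquares v c k p = true ↔
    ∀ p', p ≤ p' → p' < p + k → ∀ i < c, ∃ j < p', digit v (i + j) ≠ digit v (i + p' + j) := by
  induction k generalizing p with
  | zero => simp [noSquares]; omega
  | succ k ih =>
    rw [noSquares, Bool.and_eq_true, noSquare_iff hp, ih (by omega)]
    constructor
    · rintro ⟨h1, h2⟩ p' hp1 hp2
      rcases hp1.eq_or_lt with rfl | h
      · exact h1
      · exact h2 p' h (by omega)
    · intro h
      exact ⟨h p le_rfl (by omega), fun p' h1 h2 => h p' (by omega) (by omega)⟩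

/-- The circular word of length `n` with code `v` has no square of period at most `P`. -/
def circularNoSquares (P n v : ℕ) : Bool := noSquares (v + 4 ^ n * v) n P 1

/-- Up to the period of www⋯ a square starts in the first copy of w, and as 2P is at most the length
it ends within the second copy. So the code of ww carries all the information. -/
theorem circularNoSquares_iff {P : ℕ} {w : List (Fin 3)} (hP : 2 * P ≤ w.length) :
    circularNoSquares P w.length (code w) = true ↔
      ∀ i p, 0 < p → p ≤ P → ¬ SquareAt (periodic w) i p := by
  rw [circularNoSquares, noSquares_iff one_pos]
  have key : ∀ i < w.length, ∀ p ≤ P,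
      (∃ j < p, digit (code w + 4 ^ w.length * code w) (i + j) ≠
        digit (code w + 4 ^ w.length * code w) (i + p + j)) ↔ ¬ SquareAt (periodic w) i p := by
    intro i hi p hp
    simp only [SquareAt, not_forall, exists_prop]
    refine exists_congr fun j => and_congr_right fun hj => ?_
    rw [digit_code_append_self (by omega), digit_code_append_self (by omega), Ne, Fin.ext_iff]
  constructor
  · intro h i p hp hpP hs
    have hn : 0 < w.length := by omega
    have hi := Nat.mod_lt i hn
    refine (key _ hi p hpP).1 (h p hp (by omega) _ hi) fun j hj => ?_
    have h0 := hs j hj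
    rw [← periodic_mod, ← periodic_mod w (i + p + j)] at h0
    rw [← periodic_mod, ← periodic_mod w (i % w.length + p + j)]
    simpa [Nat.add_mod, Nat.add_assoc] using h0
  · intro h p hp hpP i hi
    exact (key i hi p (by omega)).2 (h i p hp (by omega))

theorem circularNoSquares_half_iff (w : List (Fin 3)) :
    circularNoSquares (w.length / 2) w.length (code w) = true ↔
      CircularSquareFree (w : Cycle (Fin 3)) := by
  rw [circularNoSquares_iff (by omega), circularSquareFree_coe_iff]
  refine forall₂_congr fun i p => forall_congr' fun _ => ?_
  rw [Nat.le_div_iff_mul_le two_pos, mul_comm]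

theorem not_circularSquareFree_of_circularNoSquares {P : ℕ} {w : List (Fin 3)}
    (hP : 2 * P ≤ w.length) (h : circularNoSquares P w.length (code w) = false) :
    ¬ CircularSquareFree (w : Cycle (Fin 3)) := by
  intro hc
  rw [circularSquareFree_coe_iff] at hc
  have := (circularNoSquares_iff hP).2 fun i p hp hpP => hc i p hp (by omega)
  simp [h] at this

/-- The code of the word that arises from the word of length `n` with code `v` by rotating it
by `g` and adding the letter `a` in front. -/
def extend (n v g a : ℕ) : ℕ := a + 4 * (v / 4 ^ g + 4 ^ (n - g) * (v % 4 ^ g))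

theorem code_cons_rotate {w : List (Fin 3)} {g : ℕ} (hg : g ≤ w.length) (a : Fin 3) :
    code (a :: w.rotate g) = extend w.length (code w) g a := by
  rw [List.rotate_eq_drop_append_take hg, extend, code_mod hg, code_div, code, code_append,
    List.length_drop]


/-! ### Backtracking search for extremal words of excluded lengths -/

theorem code_inj {u v : List (Fin 3)} (hl : u.length = v.length) (h : code u = code v) :
    u = v := by
  induction u generalizing v with
  | nil => exact (List.length_eq_zero_iff.1 hl.symm).symm
  | cons a u ih =>
    cases v with
    | nil => simp at hl
    | cons b v =>
      simp only [code] at h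
      simp only [List.length_cons, add_left_inj] at hl
      rw [ih hl (by omega), Fin.ext (by omega : a.val = b.val)]

/-- The word with code `v` has no prefix that is a square whose period is one of the `k` numbers
from `p` on, where `q = 4 ^ p`. -/
def noPrefixSquares (v : ℕ) : ℕ → ℕ → Bool
  | 0, _ => true
  | k + 1, q => !Nat.beq (v % q) (v / q % q) && noPrefixSquares v k (q * 4)

/-- The search adds letters in front, so any newly created square is a prefix and no other position
has to be inspected. -/
theorem not_squareFree_of_noPrefixSquares {w : List (Fin 3)} {k p : ℕ} (hp : 0 < p)
    (hk : 2 * (p + k) ≤ w.length + 2) (h : noPrefixSquares (code w) k (4 ^ p) = false) :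
    ∃ x : List (Fin 3), x ≠ [] ∧ (x ++ x) <+: w := by
  induction k generalizing p with
  | zero => simp [noPrefixSquares] at h
  | succ k ih =>
    rw [noPrefixSquares, Bool.and_eq_false_iff] at h
    rcases h with h | h
    · rw [Bool.not_eq_false', Nat.beq_eq, code_div, code_mod (by omega),
        code_mod (by simp; omega)] at h
      have h' := code_inj (by simp; omega) h
      refine ⟨w.take p, ?_, ?_⟩
      · intro h0
        have := congrArg List.length h0
        simp only [List.length_take, List.length_nil] at this
        omega
      · have : w.take p ++ w.take p = w.take (p + p) := by rw [List.take_add, ← h']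
        rw [this]
        exact List.take_prefix _ _
    · rw [← pow_succ] at h
      exact ih (by omega) (by omega) h

/-- One of the first `g` rotations of the word of length `n` with code `v` extends to a
square-free circular word. -/
def hasSquareFreeExtension (n v : ℕ) : ℕ → Bool
  | 0 => false
  | g + 1 => circularNoSquares ((n + 1) / 2) (n + 1) (extend n v g 0) ||
      (circularNoSquares ((n + 1) / 2) (n + 1) (extend n v g 1) ||
      (circularNoSquares ((n + 1) / 2) (n + 1) (extend n v g 2) || hasSquareFreeExtension n v g))

theorem exists_of_hasSquareFreeExtension {w : List (Fin 3)} {g : ℕ} (hg : g ≤ w.length)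
    (h : hasSquareFreeExtension w.length (code w) g = true) :
    ∃ g a, CircularSquareFree ((a :: w.rotate g : List (Fin 3)) : Cycle (Fin 3)) := by
  induction g with
  | zero => simp [hasSquareFreeExtension] at h
  | succ g ih =>
    have key : ∀ a : Fin 3,
        circularNoSquares ((w.length + 1) / 2) (w.length + 1) (extend w.length (code w) g a) = true →
        CircularSquareFree ((a :: w.rotate g : List (Fin 3)) : Cycle (Fin 3)) := by
      intro a ha
      rw [← circularNoSquares_half_iff]
      simpa [code_cons_rotate (by omega : g ≤ w.length)] using ha
    simp only [hasSquareFreeExtension, Bool.or_eq_true] at h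
    rcases h with h | h | h | h
    · exact ⟨g, _, key 0 h⟩
    · exact ⟨g, _, key 1 h⟩
    · exact ⟨g, _, key 2 h⟩
    · exact ih (by omega) h

/-- The circular word of length `n` with code `v` is not extremal square-free. -/
def notExtremal (n v : ℕ) : Bool :=
  !circularNoSquares (n / 2) n v || hasSquareFreeExtension n v n

theorem not_extremalSquareFree_of_notExtremal {w : List (Fin 3)}
    (h : notExtremal w.length (code w) = true) :
    ¬ ExtremalSquareFree (w : Cycle (Fin 3)) := by
  rw [extremalSquareFree_coe_iff]
  rintro ⟨h1, h2⟩
  rw [notExtremal, (circularNoSquares_half_iff w).2 h1] at h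
  obtain ⟨g, a, hc⟩ := exists_of_hasSquareFreeExtension le_rfl (by simpa using h)
  exact h2 g a hc

/-- The set `{2, 3, 5, 7, 9, 10, 11, 12, 14, 17, 19, 25, 26, 27, 29, 31, 37}` of the lengths from
two on in which there is no extremal square-free circular word, as a bit mask. -/
def isExcluded (n : ℕ) : Bool := Nat.beq (Nat.land (Nat.shiftRight 140358868652 n) 1) 1

/-- The word with code `v` starts with `2120210`, up to a permutation of the letters. -/
def startsWithPattern (v : ℕ) : Bool :=
  Nat.beq (v % 4) (v / 16 % 4) && (Nat.beq (v % 4) (v / 256 % 4) &&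
  (Nat.beq (v / 4 % 4) (v / 1024 % 4) && (Nat.beq (v / 64 % 4) (v / 4096 % 4) &&
  (!Nat.beq (v % 4) (v / 4 % 4) && (!Nat.beq (v % 4) (v / 64 % 4) &&
  !Nat.beq (v / 4 % 4) (v / 64 % 4))))))

theorem exists_perm_of_ne : ∀ a b c : Fin 3, c ≠ b → c ≠ a → b ≠ a →
    ∃ σ : Equiv.Perm (Fin 3), σ 2 = c ∧ σ 1 = b ∧ σ 0 = a := by decide

theorem exists_perm_of_startsWithPattern {l : List (Fin 3)} (hl : 7 ≤ l.length)
    (h : startsWithPattern (code l) = true) :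
    ∃ (σ : Equiv.Perm (Fin 3)) (t : List (Fin 3)),
      l = ([2, 1, 2, 0, 2, 1, 0] : List (Fin 3)).map σ ++ t := by
  match l, hl with
  | x0 :: x1 :: x2 :: x3 :: x4 :: x5 :: x6 :: t, _ =>
    have d : ∀ i, digit (code (x0 :: x1 :: x2 :: x3 :: x4 :: x5 :: x6 :: t)) i =
        code (x0 :: x1 :: x2 :: x3 :: x4 :: x5 :: x6 :: t) / 4 ^ i % 4 := fun i => rfl
    simp only [startsWithPattern, Bool.and_eq_true, Bool.not_eq_true', Nat.beq_eq,
      ← Bool.not_eq_true] at h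
    have d0 := (d 0).symm.trans (digit_code (by simp))
    have d1 := (d 1).symm.trans (digit_code (by simp))
    have d2 := (d 2).symm.trans (digit_code (by simp))
    have d3 := (d 3).symm.trans (digit_code (by simp))
    have d4 := (d 4).symm.trans (digit_code (by simp))
    have d5 := (d 5).symm.trans (digit_code (by simp))
    have d6 := (d 6).symm.trans (digit_code (by simp))
    norm_num at d0 d1 d2 d3 d4 d5 d6
    simp only [d0, d1, d2, d3, d4, d5, d6, ← Fin.ext_iff] at h
    obtain ⟨rfl, rfl, rfl, rfl, h1, h2, h3⟩ := h
    obtain ⟨σ, rfl, rfl, rfl⟩ := exists_perm_of_ne x3 x1 x0 h1 h2 h3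
    exact ⟨σ, t, rfl⟩

/-- No word of an excluded length that ends with the word of length `n` with code `v`, and has at
most `k` letters before it, is extremal square-free. With `avoid` set, words containing the
pattern are left out. -/
def search (avoid : Bool) : ℕ → ℕ → ℕ → Bool
  | 0, n, v => !noPrefixSquares v (n / 2) 4 || (!isExcluded n || notExtremal n v)
  | k + 1, n, v => !noPrefixSquares v (n / 2) 4 ||
      ((avoid && (Nat.ble 7 n && startsWithPattern v)) ||
      ((!isExcluded n || notExtremal n v) && (search avoid k (n + 1) (4 * v) &&
        (search avoid k (n + 1) (1 + 4 * v) && search avoid k (n + 1) (2 + 4 * v)))))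

theorem noPrefixSquares_of_extremalSquareFree {r l : List (Fin 3)}
    (h : ExtremalSquareFree ((r ++ l : List (Fin 3)) : Cycle (Fin 3))) :
    noPrefixSquares (code l) (l.length / 2) 4 = true := by
  by_contra hcon
  obtain ⟨x, hx0, hx1⟩ := not_squareFree_of_noPrefixSquares (w := l) (p := 1)
    (k := l.length / 2) one_pos (by omega) (by simpa using hcon)
  exact h.1 _ rfl x hx0 (hx1.isInfix.trans (List.suffix_append _ _).isInfix)

/-- Rotating the circular word brings the pattern to the end, and the inverse letter permutation
turns it into 2120210 itself, the case covered by `ha`. -/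
theorem not_extremalSquareFree_of_startsWithPattern
    (ha : ∀ r : List (Fin 3), isExcluded (r.length + 7) = true →
      ¬ ExtremalSquareFree ((r ++ [2, 1, 2, 0, 2, 1, 0] : List (Fin 3)) : Cycle (Fin 3)))
    {r l : List (Fin 3)} (hl : 7 ≤ l.length) (h : startsWithPattern (code l) = true)
    (he : isExcluded (r.length + l.length) = true) :
    ¬ ExtremalSquareFree ((r ++ l : List (Fin 3)) : Cycle (Fin 3)) := by
  intro hx
  obtain ⟨σ, t, rfl⟩ := exists_perm_of_startsWithPattern hl h
  have h4 : ((r ++ (([2, 1, 2, 0, 2, 1, 0] : List (Fin 3)).map σ ++ t) : List (Fin 3)) :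
      Cycle (Fin 3)) = ((t ++ r ++ ([2, 1, 2, 0, 2, 1, 0] : List (Fin 3)).map σ :
      List (Fin 3)) : Cycle (Fin 3)) := by
    rw [← List.append_assoc, List.append_assoc t]
    exact Cycle.coe_eq_coe.2 List.isRotated_append
  rw [h4] at hx
  have h5 := extremalSquareFree_map σ.symm hx
  have h6 : (t ++ r ++ ([2, 1, 2, 0, 2, 1, 0] : List (Fin 3)).map σ).map σ.symm =
      (t ++ r).map σ.symm ++ [2, 1, 2, 0, 2, 1, 0] := by simp
  rw [h6] at h5
  refine ha _ ?_ h5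
  have h7 : ((t ++ r).map σ.symm).length + 7 = r.length +
      (([2, 1, 2, 0, 2, 1, 0] : List (Fin 3)).map σ ++ t).length := by
    simp only [List.length_map, List.length_append, List.length_cons, List.length_nil]
    omega
  rwa [h7]

theorem not_extremalSquareFree_of_search {avoid : Bool}
    (ha : avoid = true → ∀ r : List (Fin 3), isExcluded (r.length + 7) = true →
      ¬ ExtremalSquareFree ((r ++ [2, 1, 2, 0, 2, 1, 0] : List (Fin 3)) : Cycle (Fin 3)))
    {k : ℕ} {l : List (Fin 3)} (h : search avoid k l.length (code l) = true)
    {r : List (Fin 3)} (hr : r.length ≤ k) (he : isExcluded (r.length + l.length) = true) :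
    ¬ ExtremalSquareFree ((r ++ l : List (Fin 3)) : Cycle (Fin 3)) := by
  intro hx
  -- The case in which nothing is left to prepend; it is kept outside the induction so that it can
  -- be supplied anew for `a :: l`.
  have hnil : r = [] → !isExcluded l.length || notExtremal l.length (code l) → False := by
    rintro rfl h1
    rw [List.length_nil, Nat.zero_add] at he
    rw [he] at h1
    exact not_extremalSquareFree_of_notExtremal h1 hx
  induction k generalizing l r with
  | zero =>
    rw [search, noPrefixSquares_of_extremalSquareFree hx] at h
    exact hnil (List.length_eq_zero_iff.1 (by omega)) h
  | succ k ih =>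
    rw [search, noPrefixSquares_of_extremalSquareFree hx, Bool.not_true, Bool.false_or,
      Bool.or_eq_true, Bool.and_eq_true, Bool.and_eq_true, Bool.and_eq_true] at h
    rcases h with ⟨h1, h2, h3⟩ | ⟨h1, h2⟩
    · exact not_extremalSquareFree_of_startsWithPattern (ha h1) (Nat.le_of_ble_eq_true h2) h3 he hx
    · rcases r.eq_nil_or_concat with hr0 | ⟨r', a, hr'⟩
      · exact hnil hr0 h1
      · have e : r ++ l = r' ++ a :: l := by simp [hr']
        have hlen : r.length = r'.length + 1 := by simp [hr']
        have hlen' : r.length + l.length = r'.length + (a :: l).length := by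
          rw [hlen, List.length_cons]; omega
        rw [e] at hx
        rw [hlen'] at he
        have hc : search avoid k (l.length + 1) (a.val + 4 * code l) = true := by
          rw [Bool.and_eq_true, Bool.and_eq_true] at h2
          match a with
          | 0 => rw [← h2.1]; congr 1; exact Nat.zero_add _
          | 1 => exact h2.2.1
          | 2 => exact h2.2.2
        refine ih (l := a :: l) (r := r') hc (by omega) he hx ?_
        rintro rfl h1
        rw [List.length_nil, Nat.zero_add] at he
        rw [he] at h1
        exact not_extremalSquareFree_of_notExtremal h1 hx


/-! ### Substitution of marked blocks preserves circular square-freeness -/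

variable {ι : Type*}

/-- The factor of length `n` at position `i` of the infinite word `W`. -/
def seg (W : ℕ → α) (i n : ℕ) : List α := (List.range n).map fun j => W (i + j)

section seg
variable (W : ℕ → α)

@[simp] theorem length_seg (i n : ℕ) : (seg W i n).length = n := by simp [seg]

@[simp] theorem getElem_seg (i n j : ℕ) (h : j < (seg W i n).length) :
    (seg W i n)[j] = W (i + j) := by simp [seg]

theorem seg_add (i m n : ℕ) : seg W i (m + n) = seg W i m ++ seg W (i + m) n := by
  simp [seg, List.range_add, Nat.add_assoc]

theorem seg_eq_seg_iff {i i' n : ℕ} :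
    seg W i n = seg W i' n ↔ ∀ j < n, W (i + j) = W (i' + j) := by
  simp [seg]

theorem take_seg {i m n : ℕ} (h : m ≤ n) : (seg W i n).take m = seg W i m := by
  obtain ⟨k, rfl⟩ := Nat.exists_eq_add_of_le h
  rw [seg_add, List.take_left' (by simp)]

theorem drop_seg {i m n : ℕ} (h : m ≤ n) : (seg W i n).drop m = seg W (i + m) (n - m) := by
  obtain ⟨k, rfl⟩ := Nat.exists_eq_add_of_le h
  rw [seg_add, List.drop_left' (by simp), Nat.add_sub_cancel_left]

theorem seg_infix {i n i' n' : ℕ} (h : i ≤ i') (h' : i' + n' ≤ i + n) :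
    seg W i' n' <:+: seg W i n := by
  refine ⟨seg W i (i' - i), seg W (i' + n') (i + n - (i' + n')), ?_⟩
  obtain ⟨d, rfl⟩ := Nat.exists_eq_add_of_le h
  obtain ⟨r, hr⟩ := Nat.exists_eq_add_of_le h'
  obtain rfl : n = d + n' + r := by omega
  rw [seg_add, seg_add, Nat.add_sub_cancel_left, hr, Nat.add_sub_cancel_left, ← Nat.add_assoc]

theorem not_squareAt_of_squareFree {i n i' p : ℕ} (hw : SquareFree (seg W i n)) (hp : 0 < p)
    (h : i ≤ i') (h' : i' + 2 * p ≤ i + n) : ¬ SquareAt W i' p := by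
  intro hs
  refine hw (seg W i' p) (fun h0 => ?_) ?_
  · have := congrArg List.length h0
    simp at this
    omega
  · have e : seg W i' p ++ seg W i' p = seg W i' (p + p) := by
      rw [seg_add, (seg_eq_seg_iff W).2 hs]
    rw [e]
    exact seg_infix W h (by omega)

end seg

/-- The length of the longest common prefix of two words. -/
def lcp [DecidableEq α] : List α → List α → ℕ
  | a :: u, b :: v => if a = b then lcp u v + 1 else 0
  | _, _ => 0

theorem le_lcp [DecidableEq α] {u v : List α} {t : ℕ} (hu : t ≤ u.length) (hv : t ≤ v.length)
    (h : u.take t = v.take t) : t ≤ lcp u v := by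
  induction t generalizing u v with
  | zero => exact Nat.zero_le _
  | succ t ih =>
    match u, v with
    | [], _ => simp at hu
    | _ :: _, [] => simp at hv
    | a :: u, b :: v =>
      simp only [List.take_succ_cons, List.cons.injEq] at h
      simp only [List.length_cons, add_le_add_iff_right] at hu hv
      simpa [lcp, h.1] using ih hu hv h.2

/-- Words, sorted into classes, that can be substituted for the letters of a square-free circular
word: each of them starts with the marker `M`, the marker has no further occurrence in a product
of the words, and words from different classes overlap little. -/
structure MarkedCode [DecidableEq α] (M : List α) (F : ι → Set (List α)) : Prop where
  marker_ne_nil : M ≠ []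
  marker_prefix : ∀ c, ∀ b ∈ F c, M <+: b
  length_le : ∀ c, ∀ b ∈ F c, 2 * M.length ≤ b.length
  marker_unique : ∀ c, ∀ b ∈ F c, ∀ x, 0 < x → x < b.length → ¬ M <+: (b ++ M).drop x
  squareFree : ∀ c c', c ≠ c' → ∀ b ∈ F c, ∀ b' ∈ F c', SquareFree (b ++ b' ++ M)
  lcp_lt : ∀ c c', c ≠ c' → ∀ b ∈ F c, ∀ b' ∈ F c', lcp b b' < b.length
  overlap : ∀ c c₁ c₂, c ≠ c₁ → c ≠ c₂ → ∀ b ∈ F c, ∀ b₁ ∈ F c₁, ∀ b₂ ∈ F c₂,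
    lcp b b₁ + lcp b.reverse b₂.reverse + M.length ≤ b.length

/-- The infinite word `W` is the product of words of the classes `u 0, u 1, …`, which start at
the positions `B 0 = 0, B 1, …`. -/
structure Factorization (F : ι → Set (List α)) (W : ℕ → α) (B : ℕ → ℕ) (u : ℕ → ι) : Prop where
  zero : B 0 = 0
  le : ∀ m, B m ≤ B (m + 1)
  mem : ∀ m, seg W (B m) (B (m + 1) - B m) ∈ F (u m)

section
variable [DecidableEq α] {M : List α} {F : ι → Set (List α)} {W : ℕ → α} {B : ℕ → ℕ} {u : ℕ → ι}

namespace Factorization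

theorem add_le (h : Factorization F W B u) (hF : MarkedCode M F) (m : ℕ) :
    B m + 2 * M.length ≤ B (m + 1) := by
  have h1 := hF.length_le _ _ (h.mem m)
  have h2 := h.le m
  rw [length_seg] at h1
  omega

theorem strictMono (h : Factorization F W B u) (hF : MarkedCode M F) : StrictMono B := by
  refine strictMono_nat_of_lt_succ fun m => ?_
  have h1 := h.add_le hF m
  have h2 := List.length_pos_iff.2 hF.marker_ne_nil
  omega

theorem exists_block (h : Factorization F W B u) (hF : MarkedCode M F) (q : ℕ) :
    ∃ m, B m ≤ q ∧ q < B (m + 1) := by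
  have hex : ∃ m, q < B (m + 1) :=
    ⟨q, (Nat.lt_succ_self q).trans_le ((h.strictMono hF).le_apply)⟩
  refine ⟨Nat.find hex, ?_, Nat.find_spec hex⟩
  rcases Nat.eq_zero_or_pos (Nat.find hex) with h0 | h0
  · rw [h0, h.zero]; exact Nat.zero_le _
  · have := Nat.find_min hex (m := Nat.find hex - 1) (by omega)
    rw [Nat.sub_add_cancel h0] at this
    omega

theorem seg_marker (h : Factorization F W B u) (hF : MarkedCode M F) (m : ℕ) :
    seg W (B m) M.length = M := by
  have h1 := List.prefix_iff_eq_take.1 (hF.marker_prefix _ _ (h.mem m))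
  have h2 := h.add_le hF m
  rw [take_seg W (by omega)] at h1
  exact h1.symm

/-- Synchronisation: an occurrence of the marker starting in a block lies in that block followed by
the next marker, where `marker_unique` allows it only at the start. -/
theorem exists_eq_of_seg_eq (h : Factorization F W B u) (hF : MarkedCode M F) {q : ℕ}
    (hq : seg W q M.length = M) : ∃ m, B m = q := by
  obtain ⟨m, hm1, hm2⟩ := h.exists_block hF q
  refine ⟨m, ?_⟩
  by_contra hne
  refine hF.marker_unique _ _ (h.mem m) (q - B m) (by omega) (by rw [length_seg]; omega) ?_
  have e : seg W (B m) (B (m + 1) - B m) ++ M =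
      seg W (B m) (B (m + 1) - B m + M.length) := by
    rw [seg_add]
    congr 1
    rw [Nat.add_sub_cancel' (by omega), h.seg_marker hF]
  rw [e, drop_seg W (by omega), Nat.add_sub_cancel' hm1]
  rw [List.prefix_iff_eq_take, take_seg W (by omega), hq]

/-- Inside a square, the boundaries in the first half are shifted to boundaries. -/
theorem exists_eq_add (h : Factorization F W B u) (hF : MarkedCode M F) {i p m : ℕ}
    (hs : SquareAt W i p) (h1 : i ≤ B m) (h2 : B m + M.length ≤ i + p) :
    ∃ m', B m' = B m + p := by
  refine h.exists_eq_of_seg_eq hF ?_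
  rw [← h.seg_marker hF m, length_seg, eq_comm, seg_eq_seg_iff]
  intro j hj
  have := hs (B m - i + j) (by omega)
  convert this using 2 <;> omega

/-- Inside a square, the boundaries in the second half are shifted to boundaries. -/
theorem exists_add_eq (h : Factorization F W B u) (hF : MarkedCode M F) {i p m : ℕ}
    (hs : SquareAt W i p) (h1 : i + p ≤ B m) (h2 : B m + M.length ≤ i + 2 * p) :
    ∃ m', B m' + p = B m := by
  obtain ⟨m', hm'⟩ := h.exists_eq_of_seg_eq hF (q := B m - p) (by
    rw [← h.seg_marker hF m, length_seg, seg_eq_seg_iff]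
    intro j hj
    have := hs (B m - p - i + j) (by omega)
    convert this using 2 <;> omega)
  exact ⟨m', by omega⟩

/-- A square whose first half contains no marker lies in the product of two words. -/
theorem not_squareAt_of_forall (h : Factorization F W B u) (hF : MarkedCode M F)
    (hu : ∀ m, u m ≠ u (m + 1)) {i p : ℕ} (hp : 0 < p)
    (hno : ∀ m, i ≤ B m → i + p < B m + M.length) : ¬ SquareAt W i p := by
  intro hs
  obtain ⟨m, hm1, hm2⟩ := h.exists_block hF i
  have hμ := List.length_pos_iff.2 hF.marker_ne_nil
  -- Otherwise the marker at `B (m + 2)` lies in the second half, and shifting it back by p gives a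
  -- marker in the first half.
  have hend : i + 2 * p < B (m + 2) + M.length := by
    by_contra hcon
    have h1 := hno (m + 1) hm2.le
    have h2 : B (m + 1) + 2 * M.length ≤ B (m + 2) := h.add_le hF (m + 1)
    obtain ⟨m', hm'⟩ := h.exists_add_eq hF hs (m := m + 2) (by omega) (by omega)
    have := hno m' (by omega)
    omega
  have hsf := hF.squareFree _ _ (hu m) _ (h.mem m) _ (h.mem (m + 1))
  have h1 := h.le m
  have h2 : B (m + 1) ≤ B (m + 2) := h.le (m + 1)
  have e : seg W (B m) (B (m + 1) - B m) ++ seg W (B (m + 1)) (B (m + 1 + 1) - B (m + 1)) ++ M =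
      seg W (B m) (B (m + 2) - B m + M.length) := by
    have e1 : B (m + 2) - B m = (B (m + 1) - B m) + (B (m + 2) - B (m + 1)) := by omega
    have e2 : B m + (B (m + 1) - B m + (B (m + 2) - B (m + 1))) = B (m + 2) := by omega
    rw [e1, seg_add, seg_add, e2, h.seg_marker hF, Nat.add_sub_cancel' h1]
  rw [e] at hsf
  exact not_squareAt_of_squareFree W hsf hp hm1 (by omega) hs

theorem eq_of_seg_eq (h : Factorization F W B u) (hF : MarkedCode M F) {m m' : ℕ}
    (hl : B (m + 1) - B m = B (m' + 1) - B m')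
    (hs : seg W (B m) (B (m + 1) - B m) = seg W (B m') (B (m + 1) - B m)) : u m = u m' := by
  by_contra hne
  have h1 := h.mem m'
  rw [← hl, ← hs] at h1
  have h2 := hF.lcp_lt _ _ hne _ (h.mem m) _ h1
  have := le_lcp le_rfl le_rfl (rfl : List.take
    (seg W (B m) (B (m + 1) - B m)).length (seg W (B m) (B (m + 1) - B m)) = _)
  omega

/-- Two words from different classes that agree up to position `t` have a common prefix of
length at least `t`. -/
theorem le_lcp_of_ne (h : Factorization F W B u) (hF : MarkedCode M F) {m m' t : ℕ}
    (hne : u m ≠ u m') (hs : ∀ j < t, W (B m + j) = W (B m' + j)) :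
    t ≤ lcp (seg W (B m) (B (m + 1) - B m)) (seg W (B m') (B (m' + 1) - B m')) := by
  set b := seg W (B m) (B (m + 1) - B m) with hb
  set b' := seg W (B m') (B (m' + 1) - B m') with hb'
  have h1 := hF.lcp_lt _ _ hne _ (h.mem m) _ (h.mem m')
  have h2 := hF.lcp_lt _ _ hne.symm _ (h.mem m') _ (h.mem m)
  rw [← hb, ← hb'] at h1 h2
  have key : ∀ t' ≤ t, t' ≤ b.length → t' ≤ b'.length → t' ≤ lcp b b' ∧ t' ≤ lcp b' b := by
    intro t' ht hl hl'
    have e : b.take t' = b'.take t' := by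
      rw [hb, hb', take_seg W (by simpa [hb] using hl), take_seg W (by simpa [hb'] using hl'),
        seg_eq_seg_iff]
      exact fun j hj => hs j (by omega)
    exact ⟨le_lcp hl hl' e, le_lcp hl' hl e.symm⟩
  -- Capping t at both lengths is harmless: a common prefix as long as either block contradicts
  -- `lcp_lt`.
  have h3 := key (min t (min b.length b'.length)) (by omega) (by omega) (by omega)
  omega

theorem le_lcp_reverse (h : Factorization F W B u) {m m' s : ℕ}
    (h1 : s ≤ B (m + 1) - B m) (h2 : s ≤ B (m' + 1) - B m')
    (hs : ∀ j < s, W (B (m + 1) - s + j) = W (B (m' + 1) - s + j)) :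
    s ≤ lcp (seg W (B m) (B (m + 1) - B m)).reverse
      (seg W (B m') (B (m' + 1) - B m')).reverse := by
  have h3 := h.le m
  have h4 := h.le m'
  refine le_lcp (by simpa using h1) (by simpa using h2) ?_
  rw [List.take_reverse, List.take_reverse, length_seg, length_seg, drop_seg W (by omega),
    drop_seg W (by omega)]
  have e1 : B m + (B (m + 1) - B m - s) = B (m + 1) - s := by omega
  have e2 : B m' + (B (m' + 1) - B m' - s) = B (m' + 1) - s := by omega
  have e3 : B (m + 1) - B m - (B (m + 1) - B m - s) = s := by omega
  have e4 : B (m' + 1) - B m' - (B (m' + 1) - B m' - s) = s := by omega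
  rw [e1, e2, e3, e4, (seg_eq_seg_iff W).2 hs]

/-- Inside a square, shifting by the period maps consecutive words to consecutive words. -/
theorem shift (h : Factorization F W B u) (hF : MarkedCode M F) {i p a a' : ℕ}
    (hs : SquareAt W i p) (ha : i ≤ B a) (haa : B a' = B a + p) (t : ℕ)
    (ht : B (a + t) + M.length ≤ i + p) :
    B (a' + t) = B (a + t) + p ∧ ∀ r < t, u (a + r) = u (a' + r) := by
  have hmono := h.strictMono hF
  have hμ := List.length_pos_iff.2 hF.marker_ne_nil
  induction t with
  | zero => exact ⟨haa, fun r hr => absurd hr (Nat.not_lt_zero r)⟩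
  | succ t ih =>
    have hstep : B (a + t) + 2 * M.length ≤ B (a + t + 1) := h.add_le hF (a + t)
    have ht' : B (a + t + 1) + M.length ≤ i + p := ht
    obtain ⟨ih1, ih2⟩ := ih (by omega)
    have hge : B a ≤ B (a + t) := hmono.monotone (by omega)
    obtain ⟨m', hm'⟩ := h.exists_eq_add hF hs (m := a + t + 1) (by omega) ht'
    have hlt : a' + t < m' := by
      rw [← hmono.lt_iff_lt]; omega
    have hle : B (a' + t + 1) ≤ B m' := hmono.monotone hlt
    have hstep' : B (a' + t) + 2 * M.length ≤ B (a' + t + 1) := h.add_le hF (a' + t)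
    -- A boundary strictly before the shifted one would shift back to a boundary strictly between
    -- two consecutive ones.
    have heq : B (a' + t + 1) = B (a + t + 1) + p := by
      by_contra hne
      obtain ⟨m, hm⟩ := h.exists_add_eq hF hs (m := a' + t + 1) (by omega) (by omega)
      have h1 : a + t < m := by rw [← hmono.lt_iff_lt]; omega
      have h2 : m < a + t + 1 := by rw [← hmono.lt_iff_lt]; omega
      omega
    refine ⟨heq, fun r hr => ?_⟩
    rcases Nat.lt_succ_iff_lt_or_eq.1 hr with hr | rfl
    · exact ih2 r hr
    · refine h.eq_of_seg_eq hF (by omega) ?_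
      rw [seg_eq_seg_iff]
      intro j hj
      have := hs (B (a + r) - i + j) (by omega)
      convert this using 2 <;> omega

/-- A product of words whose classes form a square-free circular word is itself circularly
square-free. -/
theorem not_squareAt (h : Factorization F W B u) (hF : MarkedCode M F) {k n : ℕ} (hk : 2 ≤ k)
    (hB : ∀ m, B (m + k) = B m + n) (hW : ∀ i, W (i + n) = W i) (hu : ∀ m, u (m + k) = u m)
    (hsq : ∀ a d, 0 < d → 2 * d ≤ k → ¬ SquareAt u a d) {i p : ℕ} (hp : 0 < p)
    (hpn : 2 * p ≤ n) : ¬ SquareAt W i p := by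
  have hadj : ∀ m, u m ≠ u (m + 1) := fun m hm =>
    hsq m 1 one_pos hk fun j hj => by
      obtain rfl : j = 0 := by omega
      exact hm
  have hmono := h.strictMono hF
  have hμ := List.length_pos_iff.2 hF.marker_ne_nil
  -- Moving the square one period to the right guarantees that a block precedes its first boundary.
  wlog hin : n ≤ i generalizing i with hwlog
  · intro hs
    refine hwlog (i := i + n) (by omega) fun j hj => ?_
    have e1 : i + n + j = i + j + n := by omega
    have e2 : i + n + p + j = i + p + j + n := by omega
    rw [e1, e2, hW, hW, hs j hj]
  intro hs
  by_cases hno : ∀ m, i ≤ B m → i + p < B m + M.length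
  · exact h.not_squareAt_of_forall hF hadj hp hno hs
  push Not at hno
  -- the first boundary `B a` in the square
  have hexa : ∃ m, i ≤ B m := ⟨_, hno.choose_spec.1⟩
  obtain ⟨a, ha, hamin⟩ : ∃ a, i ≤ B a ∧ ∀ m, i ≤ B m → a ≤ m :=
    ⟨Nat.find hexa, Nat.find_spec hexa, fun m hm => Nat.find_min' hexa hm⟩
  have ha0 : 0 < a := by
    rcases Nat.eq_zero_or_pos a with rfl | h0
    · have := h.zero; omega
    · exact h0
  have hpre : B (a - 1) < i := by
    by_contra hcon
    have := hamin (a - 1) (by omega)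
    omega
  -- the last boundary `B e` whose marker lies in the first half
  obtain ⟨e, hae, he, hemax⟩ : ∃ e, a ≤ e ∧ B e + M.length ≤ i + p ∧
      i + p < B (e + 1) + M.length := by
    obtain ⟨m₀, hm₀, hm₀'⟩ := hno
    have hex : ∃ m, i + p < B (m + 1) + M.length := by
      refine ⟨i + p, ?_⟩
      have := hmono.le_apply (x := i + p + 1)
      omega
    have h1 := Nat.find_spec hex
    have h2 : a ≤ Nat.find hex := by
      by_contra hcon
      have h3 : B (Nat.find hex + 1) ≤ B a := hmono.monotone (by omega)
      have h4 : B a ≤ B m₀ := hmono.monotone (hamin m₀ hm₀)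
      omega
    refine ⟨Nat.find hex, h2, ?_, h1⟩
    have h3 := Nat.find_min hex (m := Nat.find hex - 1) (by omega)
    rw [Nat.sub_add_cancel (by omega)] at h3
    omega
  obtain ⟨t, rfl⟩ := Nat.exists_eq_add_of_le hae
  have hBae : B a ≤ B (a + t) := hmono.monotone hae
  obtain ⟨a', ha'⟩ := h.exists_eq_add hF hs (m := a) ha (by omega)
  obtain ⟨hend, hcls⟩ := h.shift hF hs ha ha' t he
  have hlo : a + t < a' := by rw [← hmono.lt_iff_lt]; omega
  -- no boundary strictly between `i + p` and `B a'` is the shift of a boundary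
  have hmid : ∀ m, i + p ≤ B m → B m + M.length ≤ i + 2 * p → a' ≤ m := by
    intro m h1 h2
    obtain ⟨m', hm'⟩ := h.exists_add_eq hF hs h1 h2
    have h3 : B a ≤ B m' := hmono.monotone (hamin m' (by omega))
    rw [← hmono.le_iff_le]
    omega
  have hstep1 : B (a + t + 1) + 2 * M.length ≤ B (a + t + 2) := h.add_le hF (a + t + 1)
  have hstep0 : B (a + t) + 2 * M.length ≤ B (a + t + 1) := h.add_le hF (a + t)
  -- The marker at `a + t + 1` ends beyond the middle `i + p`, so `B (a + t + 2)` is already in the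
  -- second half; by `hmid` it cannot precede `B a'`.
  have hhi : a' ≤ a + t + 2 := by
    by_contra hcon
    have h1 : B (a + t + 2) < B a' := hmono (by omega)
    have := hmid (a + t + 2) (by omega) (by omega)
    omega
  -- the number of blocks inside the square is bounded
  have hcount : t + (a' - a) < k := by
    by_contra hcon
    have h1 : B (a + k) ≤ B (a' + t) := hmono.monotone (by omega)
    rw [hB] at h1
    omega
  -- comparison of the blocks at the left end and at the right end of the halves
  have hleft : ∀ j < B a - i, W (B (a' - 1 + 1) - (B a - i) + j) =
      W (B (a - 1 + 1) - (B a - i) + j) := by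
    intro j hj
    rw [Nat.sub_add_cancel (by omega), Nat.sub_add_cancel ha0]
    have := hs j (by omega)
    convert this.symm using 2 <;> omega
  have hright : ∀ j < i + p - B (a + t), W (B (a + t) + j) = W (B (a' + t) + j) := by
    intro j hj
    have := hs (B (a + t) - i + j) (by omega)
    convert this using 2 <;> omega
  have hL1 : B (a - 1 + 1) = B a := by rw [Nat.sub_add_cancel ha0]
  rcases (by omega : a' = a + t + 1 ∨ a' = a + t + 2) with rfl | rfl
  · -- one block between the corresponding blocks
    have hsq' := hsq a (t + 1) (by omega) (by omega)
    have hsq'' := hsq (a - 1) (t + 1) (by omega) (by omega)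
    -- Block `a + t` contains the middle of the square. If its class agreed with that of the block
    -- at the right end, or with that of the block at the left end, the classes would have a square
    -- of period t + 1 starting at a, or at a - 1.
    have hne1 : u (a + t) ≠ u (a + t + 1 + t) := by
      intro hcon
      refine hsq' fun j hj => ?_
      rcases Nat.lt_succ_iff_lt_or_eq.1 hj with hj | rfl
      · rw [hcls j hj]; congr 1
      · rw [hcon]; congr 1
    have hne2 : u (a + t) ≠ u (a - 1) := by
      intro hcon
      refine hsq'' fun j hj => ?_
      match j with
      | 0 => rw [Nat.add_zero, ← hcon]; congr 1; omega
      | j + 1 =>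
        have := hcls j (by omega)
        convert this using 2 <;> omega
    have h1 := h.le_lcp_of_ne hF hne1 hright
    have h2 := h.le_lcp_reverse (m := a + t) (m' := a - 1) (s := B a - i) (by omega)
      (by omega) hleft
    -- The part of block `a + t` before the middle is a common prefix, the part after it a common
    -- suffix. Together they make up the whole block, which `overlap` forbids.
    have h3 := hF.overlap _ _ _ hne1 hne2 _ (h.mem _) _ (h.mem _) _ (h.mem _)
    rw [length_seg] at h3
    omega
  · -- two blocks between the corresponding blocks
    have hlt : B (a + t + 1) < i + p := by
      by_contra hcon
      have := hmid (a + t + 1) (by omega) (by omega)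
      omega
    have heq1 : u (a + t) = u (a + t + 2 + t) := by
      by_contra hne
      have h1 := h.le_lcp_of_ne hF hne hright
      have h2 := hF.lcp_lt _ _ hne _ (h.mem _) _ (h.mem _)
      rw [length_seg] at h2
      omega
    -- Block `a + t + 1` loses fewer than `M.length` letters to the first half, and the rest is a
    -- suffix shared with block `a - 1`. Both blocks also begin with M, so different classes would
    -- violate `overlap`.
    have heq2 : u (a + t + 1) = u (a - 1) := by
      by_contra hne
      have h2 := h.le_lcp_reverse (m := a + t + 1) (m' := a - 1) (s := B a - i)
        (by have : B (a + t + 1 + 1) = B a + p := ha'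
            omega) (by omega) hleft
      have h3 := hF.overlap _ _ _ hne hne _ (h.mem _) _ (h.mem (a - 1)) _ (h.mem _)
      have h4 : M.length ≤ lcp (seg W (B (a + t + 1)) (B (a + t + 1 + 1) - B (a + t + 1)))
          (seg W (B (a - 1)) (B (a - 1 + 1) - B (a - 1))) := by
        refine h.le_lcp_of_ne hF hne ((seg_eq_seg_iff W).1 ?_)
        rw [h.seg_marker hF, h.seg_marker hF]
      have h5 : B (a + t + 1 + 1) = B a + p := ha'
      rw [length_seg] at h3
      omega
    rcases (by omega : 2 * (t + 2) ≤ k ∨ k = 2 * t + 3) with hk' | hk'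
    · refine hsq (a - 1) (t + 2) (by omega) hk' fun j hj => ?_
      match j with
      | 0 => rw [Nat.add_zero, ← heq2]; congr 1; omega
      | j + 1 =>
        rcases (by omega : j < t ∨ j = t) with hj | rfl
        · have := hcls j (by omega)
          convert this using 2 <;> omega
        · convert heq1 using 2 <;> omega
    -- For k = 2t + 3 the class square of period t + 2 is one letter too long for the circle. Its
    -- last letter is then its first one, one turn later, and two adjacent classes coincide.
    · refine hadj (a + t) ?_
      rw [heq1, heq2, ← hu (a - 1)]
      congr 1
      omega

end Factorization
end

/-! ### Periodic factorizations from substituted words -/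

section flatten
variable [Inhabited α] [Inhabited ι]

/-- If each letter `c` of a word is replaced by a word of the class `F c`, then the periodic
continuation of the result has a periodic factorization. -/
theorem exists_factorization {F : ι → Set (List α)} {us : List ι} {bs : List (List α)}
    (hus : us ≠ []) (h : List.Forall₂ (fun c b => b ∈ F c) us bs) :
    ∃ B, Factorization F (periodic bs.flatten) B (periodic us) ∧
      ∀ m, B (m + us.length) = B m + bs.flatten.length := by
  have hk : 0 < us.length := List.length_pos_iff.2 hus
  have hlen : us.length = bs.length := h.length_eq
  set n := bs.flatten.length with hn
  -- Complete turns contribute n each; the current turn contributes the blocks already passed.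
  let B : ℕ → ℕ := fun m => m / us.length * n + ((bs.take (m % us.length)).flatten).length
  have hsucc : ∀ m, ∃ hm : m % us.length < bs.length,
      B (m + 1) = B m + (bs[m % us.length]).length := by
    intro m
    have hm : m % us.length < us.length := Nat.mod_lt _ hk
    have hm' : m % us.length < bs.length := hlen ▸ hm
    refine ⟨hm', ?_⟩
    have e : ((bs.take (m % us.length + 1)).flatten).length =
        ((bs.take (m % us.length)).flatten).length + (bs[m % us.length]).length := by
      rw [List.take_succ_eq_append_getElem hm', List.flatten_append, List.length_append,
        List.flatten_singleton]
    simp only [B]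
    rcases (by omega : m % us.length + 1 < us.length ∨ m % us.length + 1 = us.length) with h1 | h1
    · have e1 : (m + 1) / us.length = m / us.length := by
        rw [Nat.succ_div, if_neg, Nat.add_zero]
        intro hd
        have := Nat.mod_eq_zero_of_dvd hd
        rw [Nat.add_mod, Nat.mod_eq_of_lt (by omega : 1 < us.length), Nat.mod_eq_of_lt h1] at this
        omega
      have e2 : (m + 1) % us.length = m % us.length + 1 := by
        rw [← Nat.mod_add_mod, Nat.mod_eq_of_lt h1]
      rw [e1, e2, e]
      omega
    · have e2 : (m + 1) % us.length = 0 := by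
        rw [← Nat.mod_add_mod, h1, Nat.mod_self]
      have e1 : (m + 1) / us.length = m / us.length + 1 := by
        rw [Nat.succ_div, if_pos (Nat.dvd_of_mod_eq_zero e2)]
      have e3 : ((bs.take (m % us.length + 1)).flatten).length = n := by
        rw [h1, hlen, List.take_length]
      rw [e1, e2, Nat.succ_mul, List.take_zero, List.flatten_nil, List.length_nil]
      omega
  refine ⟨B, ⟨by simp [B], fun m => ?_, fun m => ?_⟩, fun m => ?_⟩
  · obtain ⟨_, e⟩ := hsucc m
    omega
  · obtain ⟨hm, e⟩ := hsucc m
    rw [e, Nat.add_sub_cancel_left]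
    have hm' : m % us.length < us.length := by omega
    have hsplit : bs.flatten = (bs.take (m % us.length)).flatten ++ bs[m % us.length] ++
        (bs.drop (m % us.length + 1)).flatten := by
      rw [List.append_assoc, ← List.flatten_cons, ← List.drop_eq_getElem_cons hm,
        ← List.flatten_append, List.take_append_drop]
    have hseg : seg (periodic bs.flatten) (B m) (bs[m % us.length]).length =
        bs[m % us.length] := by
      apply List.ext_getElem (by simp)
      intro j h1 h2
      have hl := congrArg List.length hsplit
      simp only [List.length_append] at hl
      have hj : ((bs.take (m % us.length)).flatten).length + j < bs.flatten.length := by omega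
      have e1 : periodic bs.flatten (B m + j) =
          periodic bs.flatten (((bs.take (m % us.length)).flatten).length + j) := by
        rw [← periodic_mod, ← periodic_mod bs.flatten (_ + j)]
        simp only [B]
        rw [Nat.add_assoc, Nat.mul_add_mod_self_right]
      rw [getElem_seg, e1, periodic_of_lt hj]
      simp only [hsplit]
      rw [List.getElem_append_left (by simp; omega), List.getElem_append_right (by simp)]
      simp
    rw [hseg]
    have h2 := (List.forall₂_iff_get.1 h).2 (m % us.length) hm' hm
    have e2 : periodic us m = us[m % us.length] := by
      rw [← periodic_mod, periodic_of_lt hm']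
    rw [e2]
    exact h2
  · simp only [B, Nat.add_mod_right, Nat.add_div_right _ hk, Nat.succ_mul]
    omega

theorem circularSquareFree_flatten [DecidableEq α] {M : List α} {F : ι → Set (List α)}
    (hF : MarkedCode M F) {us : List ι} {bs : List (List α)}
    (h : List.Forall₂ (fun c b => b ∈ F c) us bs) (hus : 2 ≤ us.length)
    (hsq : CircularSquareFree (us : Cycle ι)) : CircularSquareFree (bs.flatten : Cycle α) := by
  obtain ⟨B, hB, hper⟩ := exists_factorization (List.length_pos_iff.1 (by omega)) h
  rw [circularSquareFree_coe_iff] at hsq ⊢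
  intro i p hp hpn
  exact hB.not_squareAt hF hus hper (periodic_add_length _) (periodic_add_length _) hsq hp hpn

end flatten

/-! ### Closed gaps and extremality -/

section gaps

/-- Inserting any letter at position `g` of `w` yields a square, which is seen within distance
`r`. -/
def ClosedGap (r : ℕ) (w : List α) (g : ℕ) : Prop :=
  ∀ a, ¬ SquareFree ((w.drop (g - r)).take r ++ a :: (w.drop g).take r)

/-- All gaps in products of the words of the classes `F c` are closed. -/
structure ClosedGaps (r : ℕ) (F : ι → Set (List α)) : Prop where
  length_le : ∀ c, ∀ b ∈ F c, 2 * r ≤ b.length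
  single : ∀ c, ∀ b ∈ F c, ∀ g, r ≤ g → g + r ≤ b.length → ClosedGap r b g
  pair : ∀ c c', c ≠ c' → ∀ b ∈ F c, ∀ b' ∈ F c', ∀ g, b.length ≤ g + r → g ≤ b.length + r →
    ClosedGap r (b ++ b') g

theorem closedGap_seg {W : ℕ → α} {r i n g : ℕ} (h1 : r ≤ g) (h2 : g + r ≤ n) :
    ClosedGap r (seg W i n) g ↔
      ∀ a, ¬ SquareFree (seg W (i + g - r) r ++ a :: seg W (i + g) r) := by
  rw [ClosedGap, drop_seg W (by omega), drop_seg W (by omega), take_seg W (by omega),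
    take_seg W (by omega), Nat.add_sub_assoc h1]

/-- Blocks have length at least 2r, so the window of radius r around a gap meets at most two
adjacent blocks, and `single` or `pair` applies. -/
theorem Factorization.not_squareFree_insert [DecidableEq α] {M : List α} {F : ι → Set (List α)}
    {W : ℕ → α} {B : ℕ → ℕ} {u : ℕ → ι} (h : Factorization F W B u) (hF : MarkedCode M F)
    {r : ℕ} (hg : ClosedGaps r F) (hu : ∀ m, u m ≠ u (m + 1)) (q : ℕ) (a : α) :
    ¬ SquareFree (seg W q r ++ a :: seg W (q + r) r) := by
  obtain ⟨m, hm1, hm2⟩ := h.exists_block hF q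
  have h1 := h.le m
  have h2 : B (m + 1) ≤ B (m + 2) := h.le (m + 1)
  have l1 := hg.length_le _ _ (h.mem m)
  have l2 := hg.length_le _ _ (h.mem (m + 1))
  rw [length_seg] at l1 l2
  have l2' : 2 * r ≤ B (m + 2) - B (m + 1) := l2
  rcases le_or_gt (q + 2 * r) (B (m + 1)) with hq | hq
  · have := hg.single _ _ (h.mem m) (q + r - B m) (by omega) (by rw [length_seg]; omega)
    rw [closedGap_seg (by omega) (by omega)] at this
    have h3 := this a
    rwa [Nat.add_sub_cancel' (by omega), Nat.add_sub_cancel] at h3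
  · have := hg.pair _ _ (hu m) _ (h.mem m) _ (h.mem (m + 1)) (q + r - B m)
      (by rw [length_seg]; omega) (by rw [length_seg]; omega)
    have e : seg W (B m) (B (m + 1) - B m) ++ seg W (B (m + 1)) (B (m + 1 + 1) - B (m + 1)) =
        seg W (B m) (B (m + 1) - B m + (B (m + 2) - B (m + 1))) := by
      rw [seg_add, Nat.add_sub_cancel' h1]
    rw [e, closedGap_seg (by omega) (by omega)] at this
    have h3 := this a
    rwa [Nat.add_sub_cancel' (by omega), Nat.add_sub_cancel] at h3

theorem rotate_eq_seg [Inhabited α] (w : List α) (g : ℕ) :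
    w.rotate g = seg (periodic w) g w.length := by
  apply List.ext_getElem (by simp)
  intro j h1 h2
  rw [getElem_seg, ← periodic_rotate, periodic_of_lt h1]

/-- As 2r is at most the length of w, the two sides of the window do not overlap on the circle, so
the window is a factor of a conjugate of the extension. -/
theorem not_circularSquareFree_cons_rotate [Inhabited α] {w : List α} {r g : ℕ} {a : α}
    (hr : 2 * r ≤ w.length)
    (h : ¬ SquareFree (seg (periodic w) (g + w.length - r) r ++
      a :: seg (periodic w) (g + w.length) r)) :
    ¬ CircularSquareFree ((a :: w.rotate g : List α) : Cycle α) := by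
  intro hc
  refine h fun x hx hinf => ?_
  obtain ⟨d, hd⟩ := Nat.exists_eq_add_of_le hr
  have e0 : seg (periodic w) (g + w.length) r = seg (periodic w) g r := by
    rw [seg_eq_seg_iff]
    intro j _
    rw [← periodic_add_length w (g + j)]
    congr 1
    omega
  have e1 : w.rotate g = seg (periodic w) g (r + d) ++ seg (periodic w) (g + w.length - r) r := by
    have e2 : g + w.length - r = g + (r + d) := by omega
    rw [rotate_eq_seg, e2, ← seg_add]
    congr 1
    omega
  refine hc (seg (periodic w) (g + w.length - r) r ++ a :: seg (periodic w) g (r + d)) ?_ x hx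
    (hinf.trans ?_)
  · rw [e1]
    exact Cycle.coe_eq_coe.2 (List.isRotated_append (l := seg (periodic w) (g + w.length - r) r)
      (l' := a :: seg (periodic w) g (r + d)))
  · rw [e0, seg_add]
    exact ⟨[], seg (periodic w) (g + r) d, by simp⟩

/-- Substituting words with closed gaps for the letters of a square-free circular word yields an
extremal square-free circular word. -/
theorem extremalSquareFree_flatten [Inhabited α] [Inhabited ι] [DecidableEq α] {M : List α}
    {F : ι → Set (List α)} (hF : MarkedCode M F) {r : ℕ} (hg : ClosedGaps r F) {us : List ι}
    {bs : List (List α)} (h : List.Forall₂ (fun c b => b ∈ F c) us bs) (hus : 2 ≤ us.length)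
    (hsq : CircularSquareFree (us : Cycle ι)) : ExtremalSquareFree (bs.flatten : Cycle α) := by
  rw [extremalSquareFree_coe_iff]
  refine ⟨circularSquareFree_flatten hF h hus hsq, fun g a => ?_⟩
  obtain ⟨B, hB, hper⟩ := exists_factorization (List.length_pos_iff.1 (by omega)) h
  rw [circularSquareFree_coe_iff] at hsq
  have hadj : ∀ m, periodic us m ≠ periodic us (m + 1) := fun m hm =>
    hsq m 1 one_pos hus fun j hj => by
      obtain rfl : j = 0 := by omega
      exact hm
  have hlen : 2 * r ≤ bs.flatten.length := by
    match us, bs, h with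
    | c :: us, b :: bs, .cons hb _ =>
      have := hg.length_le _ _ hb
      simp only [List.flatten_cons, List.length_append]
      omega
  refine not_circularSquareFree_cons_rotate hlen ?_
  have := hB.not_squareFree_insert hF hg hadj (g + bs.flatten.length - r) a
  rwa [Nat.sub_add_cancel (by omega)] at this

end gaps

/-! ### Tests for linear words and for closed gaps -/

/-- The word of length `n` with code `v` has no square whose period is one of the `k` numbers from
`p` on. -/
def linearNoSquares (n v : ℕ) : ℕ → ℕ → Bool
  | 0, _ => true
  | k + 1, p => noSquare v (n + 1 - 2 * p) p && linearNoSquares n v k (p + 1)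

theorem linearNoSquares_iff {w : List (Fin 3)} {k p : ℕ} (hp : 0 < p) :
    linearNoSquares w.length (code w) k p = true ↔
      ∀ p', p ≤ p' → p' < p + k → ∀ i, i + 2 * p' ≤ w.length → ¬ SquareAt (periodic w) i p' := by
  induction k generalizing p with
  | zero => simp [linearNoSquares]; omega
  | succ k ih =>
    rw [linearNoSquares, Bool.and_eq_true, noSquare_iff hp, ih (by omega)]
    have key : (∀ i < w.length + 1 - 2 * p, ∃ j < p, digit (code w) (i + j) ≠
        digit (code w) (i + p + j)) ↔
        ∀ i, i + 2 * p ≤ w.length → ¬ SquareAt (periodic w) i p := by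
      refine forall_congr' fun i => ?_
      rw [show i < w.length + 1 - 2 * p ↔ i + 2 * p ≤ w.length by omega]
      refine forall_congr' fun hi => ?_
      simp only [SquareAt, not_forall, exists_prop]
      refine exists_congr fun j => and_congr_right fun hj => ?_
      rw [digit_code (by omega), digit_code (by omega), periodic_of_lt (by omega),
        periodic_of_lt (by omega), Ne, Fin.ext_iff]
    rw [key]
    constructor
    · rintro ⟨h1, h2⟩ p' hp1 hp2
      rcases hp1.eq_or_lt with rfl | h
      · exact h1
      · exact h2 p' h (by omega)
    · intro h
      exact ⟨h p le_rfl (by omega), fun p' h1 h2 => h p' (by omega) (by omega)⟩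

theorem squareFree_of_linearNoSquares {w : List (Fin 3)}
    (h : linearNoSquares w.length (code w) (w.length / 2) 1 = true) : SquareFree w := by
  rintro x hx ⟨s, t, rfl⟩
  have hxl := List.length_pos_iff.2 hx
  rw [linearNoSquares_iff one_pos] at h
  simp only [List.length_append] at h
  refine h x.length hxl (by omega) s.length (by omega) fun j hj => ?_
  rw [periodic_of_lt (by simp; omega), periodic_of_lt (by simp; omega)]
  simp [hj, Nat.add_assoc]

theorem not_squareFree_of_linearNoSquares {w : List (Fin 3)} {k : ℕ}
    (h : linearNoSquares w.length (code w) k 1 = false) : ¬ SquareFree w := by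
  intro hw
  have e : w = seg (periodic w) 0 w.length := by rw [← rotate_eq_seg, List.rotate_zero]
  have := (linearNoSquares_iff (w := w) (k := k) one_pos).2 fun p hp _ i hi =>
    not_squareAt_of_squareFree (periodic w) (e ▸ hw) hp (Nat.zero_le _) (by omega)
  simp [h] at this

/-- The gap `g` of the word with code `v` is closed by squares of period at most `k` within
distance `r`. -/
def closedGap (r k v g : ℕ) : Bool :=
  !linearNoSquares (2 * r + 1) (v / 4 ^ (g - r) % 4 ^ r + 4 ^ r * (0 + 4 * (v / 4 ^ g % 4 ^ r))) k 1 &&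
  (!linearNoSquares (2 * r + 1) (v / 4 ^ (g - r) % 4 ^ r + 4 ^ r * (1 + 4 * (v / 4 ^ g % 4 ^ r))) k 1 &&
  !linearNoSquares (2 * r + 1) (v / 4 ^ (g - r) % 4 ^ r + 4 ^ r * (2 + 4 * (v / 4 ^ g % 4 ^ r))) k 1)

theorem closedGap_of_closedGap {r k g : ℕ} {w : List (Fin 3)} (h1 : r ≤ g) (h2 : g + r ≤ w.length)
    (h : closedGap r k (code w) g = true) : ClosedGap r w g := by
  simp only [closedGap, Bool.and_eq_true, Bool.not_eq_true'] at h
  intro a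
  have hl : ((w.drop (g - r)).take r).length = r := by simp; omega
  have hc : code ((w.drop (g - r)).take r ++ a :: (w.drop g).take r) =
      code w / 4 ^ (g - r) % 4 ^ r + 4 ^ r * (a.val + 4 * (code w / 4 ^ g % 4 ^ r)) := by
    rw [code_append, hl, code, code_div, code_div, code_mod (by simp; omega),
      code_mod (by simp; omega)]
  refine not_squareFree_of_linearNoSquares (k := k) ?_
  have hn : ((w.drop (g - r)).take r ++ a :: (w.drop g).take r).length = 2 * r + 1 := by
    simp; omega
  rw [hn, hc]
  match a with
  | 0 => exact h.1
  | 1 => exact h.2.1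
  | 2 => exact h.2.2


/-- The closed gaps `g, …, g + n - 1`. -/
def closedGaps (r k v : ℕ) : ℕ → ℕ → Bool
  | 0, _ => true
  | n + 1, g => closedGap r k v g && closedGaps r k v n (g + 1)

theorem closedGap_of_closedGaps {r k v n g g' : ℕ} (h : closedGaps r k v n g = true) (h1 : g ≤ g')
    (h2 : g' < g + n) : closedGap r k v g' = true := by
  induction n generalizing g with
  | zero => omega
  | succ n ih =>
    rw [closedGaps, Bool.and_eq_true] at h
    rcases h1.eq_or_lt with rfl | h3
    · exact h.1
    · exact ih h.2 h3 (by omega)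

/-- The word of length `n` with code `v`. -/
def decode : ℕ → ℕ → List (Fin 3)
  | 0, _ => []
  | n + 1, v => Fin.ofNat 3 (v % 4) :: decode n (v / 4)

theorem length_decode (n v : ℕ) : (decode n v).length = n := by
  induction n generalizing v with
  | zero => rfl
  | succ n ih => simp [decode, ih]

/-! ### The concrete blocks and their verification -/

def marker : List (Fin 3) := [0, 1, 0, 2, 1, 0]

/-- The words to be substituted for the letters. -/
def blocks : Fin 3 → List (List (Fin 3))
  | 0 => [decode 43 46057694010334708305006980]
  | 1 => [decode 43 46057858931322087372525956]
  | 2 => [decode 26 2362173512847748,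
      decode 29 163858595623244164,
      decode 30 604716421176922500,
      decode 38 42954545786928975090052,
      decode 39 158522781513003625976196,
      decode 40 687272763058200636592516,
      decode 43 46057942600482550962229636,
      decode 45 649309313077261152003854724,
      decode 55 737953510191632147524341104677252,
      decode 61 3022657577739449414190000527892582788,
      decode 63 48362519099970560271746972009966899588,
      decode 66 3241039580205656223371188213157969039748,
      decode 68 51856633283246227509137807226926622347652,
      decode 70 792371512933917659492302389411298305937796,
      decode 73 46787666886767136793664375179443449857610116,
      decode 74 202847116303225203665712801621009232010187140,
      decode 75 748602670188274188698630002871095342429147524]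

set_option maxRecDepth 10000 in
theorem markedCode_blocks : MarkedCode marker fun c => {b | b ∈ blocks c} where
  marker_ne_nil := by decide
  marker_prefix := by
    have : ∀ c, ∀ b ∈ blocks c, marker.isPrefixOf b = true := by decide +kernel
    exact fun c b hb => List.isPrefixOf_iff_prefix.1 (this c b hb)
  length_le := by
    have : ∀ c, ∀ b ∈ blocks c, 2 * marker.length ≤ b.length := by decide +kernel
    exact this
  marker_unique := by
    have : ∀ c, ∀ b ∈ blocks c, ∀ x < b.length, 0 < x →
      marker.isPrefixOf ((b ++ marker).drop x) = false := by decide +kernel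
    intro c b hb x hx0 hx h
    have h1 := this c b hb x hx hx0
    rw [List.isPrefixOf_iff_prefix.2 h] at h1
    cases h1
  squareFree := by
    have : ∀ c c', c ≠ c' → ∀ b ∈ blocks c, ∀ b' ∈ blocks c',
      linearNoSquares (b ++ b' ++ marker).length (code (b ++ b' ++ marker))
        ((b ++ b' ++ marker).length / 2) 1 = true := by decide +kernel
    exact fun c c' hc b hb b' hb' => squareFree_of_linearNoSquares (this c c' hc b hb b' hb')
  lcp_lt := by
    have : ∀ c c', c ≠ c' → ∀ b ∈ blocks c, ∀ b' ∈ blocks c', lcp b b' < b.length := by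
      decide +kernel
    exact this
  overlap := by
    have : ∀ c c₁ c₂, c ≠ c₁ → c ≠ c₂ → ∀ b ∈ blocks c, ∀ b₁ ∈ blocks c₁, ∀ b₂ ∈ blocks c₂,
      lcp b b₁ + lcp b.reverse b₂.reverse + marker.length ≤ b.length := by decide +kernel
    exact this

set_option maxRecDepth 10000 in
theorem closedGaps_blocks : ClosedGaps 11 fun c => {b | b ∈ blocks c} where
  length_le := by
    have : ∀ c, ∀ b ∈ blocks c, 2 * 11 ≤ b.length := by decide +kernel
    exact this
  single := by
    -- The gaps 11 to `b.length - 11` number `b.length - 21`; periods up to 6 suffice to close them.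
    have : ∀ c, ∀ b ∈ blocks c, closedGaps 11 6 (code b) (b.length - 21) 11 = true := by
      decide +kernel
    intro c b hb g h1 h2
    exact closedGap_of_closedGap h1 h2 (closedGap_of_closedGaps (this c b hb) h1 (by omega))
  pair := by
    have h0 : ∀ c, ∀ b ∈ blocks c, 2 * 11 ≤ b.length := by decide +kernel
    -- The 23 gaps at distance at most 11 from the boundary between the blocks.
    have : ∀ c c', c ≠ c' → ∀ b ∈ blocks c, ∀ b' ∈ blocks c',
        closedGaps 11 6 (code (b ++ b')) 23 (b.length - 11) = true := by decide +kernel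
    intro c c' hc b hb b' hb' g h1 h2
    have h3 := h0 c b hb
    have h4 := h0 c' b' hb'
    exact closedGap_of_closedGap (by omega) (by simp; omega)
      (closedGap_of_closedGaps (this c c' hc b hb b' hb') (by omega) (by omega))


/-! ### Explicit circular words of length below 150 -/

/-- No extension of one of the first `g` rotations of the circular word of length `n` with code
`v` is free of squares of period at most `P`. -/
def noSquareFreeExtension (P n v : ℕ) : ℕ → Bool
  | 0 => true
  | g + 1 => !circularNoSquares P (n + 1) (extend n v g 0) &&
      (!circularNoSquares P (n + 1) (extend n v g 1) &&
      (!circularNoSquares P (n + 1) (extend n v g 2) && noSquareFreeExtension P n v g))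

theorem not_circularSquareFree_of_noSquareFreeExtension {P g g' : ℕ} {w : List (Fin 3)}
    (hP : 2 * P ≤ w.length + 1) (hg : g ≤ w.length) (hg' : g' < g)
    (h : noSquareFreeExtension P w.length (code w) g = true) (a : Fin 3) :
    ¬ CircularSquareFree ((a :: w.rotate g' : List (Fin 3)) : Cycle (Fin 3)) := by
  induction g with
  | zero => omega
  | succ g ih =>
    simp only [noSquareFreeExtension, Bool.and_eq_true, Bool.not_eq_true'] at h
    rcases Nat.lt_succ_iff_lt_or_eq.1 hg' with hlt | rfl
    · exact ih (by omega) hlt h.2.2.2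
    · refine not_circularSquareFree_of_circularNoSquares (P := P) (by simpa using hP) ?_
      rw [List.length_cons, List.length_rotate, code_cons_rotate (by omega)]
      match a with
      | 0 => exact h.1
      | 1 => exact h.2.1
      | 2 => exact h.2.2.1

/-- The circular word of length `n` with code `v` is square-free. -/
def checkSquareFree (n v : ℕ) : Bool :=
  Nat.beq (code (decode n v)) v && circularNoSquares (n / 2) n v

/-- The circular word of length `n` with code `v` is extremal square-free, and squares of small
period suffice to see it. -/
def checkExtremal (n v : ℕ) : Bool :=
  checkSquareFree n v && noSquareFreeExtension (min 13 ((n + 1) / 2)) n v n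

theorem circularSquareFree_of_checkSquareFree {n v : ℕ} (h : checkSquareFree n v = true) :
    CircularSquareFree (decode n v : Cycle (Fin 3)) := by
  rw [checkSquareFree, Bool.and_eq_true, Nat.beq_eq] at h
  rw [← circularNoSquares_half_iff, length_decode, h.1]
  exact h.2

theorem extremalSquareFree_of_checkExtremal {n v : ℕ} (hn : 0 < n)
    (h : checkExtremal n v = true) : ExtremalSquareFree (decode n v : Cycle (Fin 3)) := by
  rw [checkExtremal, Bool.and_eq_true] at h
  have hc : code (decode n v) = v := by
    have := h.1
    rw [checkSquareFree, Bool.and_eq_true, Nat.beq_eq] at this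
    exact this.1
  rw [extremalSquareFree_coe_iff]
  refine ⟨circularSquareFree_of_checkSquareFree h.1, fun g a => ?_⟩
  rw [← List.rotate_mod]
  -- Finding a square needs no complete test: periods up to 13 suffice for the listed words, and the
  -- minimum keeps 2P within the length n + 1.
  refine not_circularSquareFree_of_noSquareFreeExtension (P := min 13 ((n + 1) / 2)) (g := n)
    ?_ ?_ ?_ ?_ a
  · rw [length_decode]; omega
  · rw [length_decode]
  · rw [length_decode]; exact Nat.mod_lt _ hn
  · rw [length_decode, hc]; exact h.2

/-- The lengths and the codes of some extremal square-free circular words. -/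
def extremalCodes : List (ℕ × ℕ) :=
  [(4, 132),
   (6, 2148),
   (8, 34340),
   (13, 35202596),
   (15, 563186052),
   (16, 1648773220),
   (18, 36008642948),
   (20, 655286114404),
   (21, 2500283746692),
   (22, 10464981719140),
   (23, 27042340479268),
   (24, 160018159733124),
   (28, 28293288483250468),
   (30, 686315580594164100),
   (32, 10993877291670840452),
   (33, 41948243430495102084),
   (34, 154822606717256803876),
   (35, 611487816754791851108),
   (36, 2474485124224641025572),
   (38, 39630695254529172457860),
   (39, 158367047830378131851652),
   (40, 719134952990512884622468),
   (41, 2504148139401904916604004),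
   (42, 11514464732800284801255524),
   (43, 46057942600482550962229636),
   (44, 184098589195159694651827332),
   (45, 736923104165355216659948676),
   (46, 2597398697235213167385416068),
   (47, 10259116364670100916651762788),
   (48, 47218343175365244361015436420),
   (49, 188870822157163105214414595204),
   (50, 664957903001603740107082450468),
   (51, 1990963125874723160107572078116),
   (52, 7963844214549524863382724355620),
   (53, 42021343181227423658895978407012),
   (54, 193044844990551010698407679510628),
   (55, 772165449055615087907107938641028),
   (56, 2723668972578897840691227056481828),
   (57, 7880202801751456256273107182051620),
   (58, 49454072375890657415670087993823620),
   (59, 197677915657251078456274313911084132),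
   (60, 510815142826138065216988250851788900),
   (61, 3168769387144046970868202798013883524),
   (62, 12660242526050772502878100360597180804),
   (63, 50699626832997909704344112221179234404),
   (64, 130640229266999440324391967831259111716),
   (65, 773800339901829542792178271222325725572),
   (66, 3241033692509140867512186283358276587908),
   (67, 8263002421897075515393475026892441814564),
   (68, 51917117638968065570704634806025144640644),
   (69, 207665665109413812811107500588810451051652),
   (70, 721771560284857593472434105174848746628196),
   (71, 2189084828923640966646538447570594938562084),
   (72, 12676401297144569966404321966880300667914628),
   (73, 46741702416386832825886934576463542219803012),
   (74, 212649647624146193782614327444689240505853060),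
   (75, 849614493887800459072328639878322500248113540),
   (76, 3398457976135478279555833310684868655163150724),
   (77, 8767114219425784388414109699823966894727700772),
   (78, 47863503214502950965712143391793082346897508740),
   (79, 217502089290013753234366510560881813103201259908),
   (80, 756989221970369833381215746123117758387744810084),
   (81, 3066269666709598724772373686569817564463419134340),
   (82, 8977524960689724491539209387181719318403927843108),
   (83, 53175154456252544986951810690073908004454614321540),
   (84, 196241258669127713412816126381566290065546569879940),
   (85, 784965034677657273541727661210332629957548924045700),
   (86, 3403209872253168336028241692831225885329476655925636),
   (87, 13612839489012673345584935840818108511132435592286596),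
   (88, 50188520809436441336449202911787895705448273243376004),
   (89, 228330813477637271236592510914398467872096462079140996),
   (90, 803016332950982485888814582676437237173550760224659556),
   (91, 2353395264620697411300762979354343867212821869014622500),
   (92, 12860867128152414706250729534558362498838690791584532868),
   (93, 37220033733689410389917295414622897326684277814285600292),
   (94, 233376890825833786640622306259030295520805817583543666788),
   (95, 822288723913124189172898079847524563713646201784422730116),
   (96, 3250570129998521439557132260100536844282693690218426803300),
   (97, 13156619609090832685139085304533672249206649246069309933956),
   (98, 59855554612535754897151340466920054145907960044138506101892),
   (99, 154232112062182021622896715531584506892878688134259204710692),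
   (100, 842027212129800402511569872781335597897045369772983638595684),
   (101, 3368260493110804223720925009992429585101169019551241981958244),
   (102, 15305348878487809823939001097670693271347471929133151004430724),
   (103, 53942386439078185612086241976337740045016723050720489570341252),
   (104, 245171656228028856099288987614121467253774006034870759904912516),
   (105, 863165151978161186649895006815767985601829155446047978435003940),
   (106, 2584417966040904906747806650577245349153136422835160335974999588),
   (107, 13795715563222028973652438343926549507928274855513076904367528036),
   (108, 59862612609040865520161013989392200179447407221245583925749107076),
   (109, 239450450436163462080644055957568800717792435485941620971414112644),
   (110, 882925796046129179628847292567074462251209246227252692963467299204),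
   (111, 2587585458151799847447306300955659799808335806628216596205315186980),
   (112, 10350381585323921910018407460045422435962229451297120081842088861988),
   (113, 56507250946957430676897062909557897383859505971631334470459913967716),
   (114, 223377478427169233009594638441031245673027650861169661832808565384292),
   (115, 1027124576417281776512931983721415752400254257285244478429134660866436),
   (116, 4113242392716556097228023695532055070325459149249076930805020294931588),
   (117, 16422439193987448080850846741596286525540370201846630146878695455103076),
   (118, 43359292145825729369921662366988710667620433143555173829742826956072484),
   (119, 262944369229289030951412115745813383190385797834156698555926209513165188),
   (120, 925818710640524311588120690574345750419796490905662401672472650172635236),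
   (121, 3660575262439879221257593876308964039079484439178026304334080040895915108),
   (122, 14813036792239208707150413696482867795037030714322736092542747634187933796),
   (123, 67392271705249328126562338516741641490988369681193344347219260418291950724),
   (124, 171647109175051177235820750371791364739517400202056637183188296767797233188),
   (125, 1028557074945395549187779481387999793193545198637111139401443181946677531012),
   (126, 4308072721970544870599380285825335093696369074002545682939435207241452786052),
   (127, 17232290876483284796471589323673569467170798349182884332919354206818438254980),
   (128, 65827652796460180404886052114703665114997212063806980590979203024116988285316),
   (129, 242935455794334923387123128930542051336207333436600684536691780883400271368580),
   (130, 971739645866031268330015172007976660896193559487238524237272827743675004522884),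
   (131, 4411474478543535598702526570884512225475273179577579365844007097882954573123972),
   (132, 17645802673350871834542714397470235570406612023268916655657864548144956473184644),
   (133, 70583210681264993112126901598676983600537865463062413177821729785336537681269124),
   (134, 282333853736325008361434505592642969958073420877750836596906060532363289321116036),
   (135, 1078520215607514025738600054665933070919674644186831074753122496336946756863955332),
   (136, 3980254507734394783669187670391095293522818543126443179759619378260579904118100356),
   (137, 15920982357869058905553011705433204826468262025913082406671744864828722023706956164),
   (138, 72277466552397347354979972987113476137061092670949514790788695159371294991748206980),
   (139, 289109866209584531604141484200323209524677815077377103905644711694539274780600996228),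
   (140, 1156441565704303911674786748365020618272145534223099695202534273057400328906439168388),
   (141, 4625757859353352505669157789750361546821498987307556911318255244103811335025577202052),
   (142, 17670475995859477622439399219446307852936714656979945065095937065536931584058429313412),
   (143, 74012260205012263144550999028885739217920834477344060393877908545174562871114020196740),
   (144, 260849958604518108171553456507065112200921623242522748980610966025029168998272367890820),
   (145, 1043399837675525186155982673585489109938419780307550628911470477749471178579425447416196),
   (146, 4523641654404410975601320948031518478727423469471632104428116604070845956080437690929540),
   (147, 18947036348427841315612120363050079166995193307112482884521868389754762466064128842174852),
   (148, 72378269678958917546639917838368242312103291346733703790354703508503167313680878628540804),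
   (149, 303153667087790817419545713598101285763208000447696277527002339037829851227989048608199044)]

/-- The lengths and the codes of some square-free circular words. -/
def squareFreeCodes : List (ℕ × ℕ) :=
  [(11, 1646884),
   (19, 156306531460),
   (25, 589992753926532),
   (26, 2359862874940516),
   (27, 6916036152074532),
   (29, 151179075993617956),
   (31, 1810879734975071780),
   (37, 9898435893050517588356)]

set_option maxRecDepth 10000 in
theorem checkExtremal_of_mem : ∀ e ∈ extremalCodes, checkExtremal e.1 e.2 = true := by
  decide +kernel

set_option maxRecDepth 10000 in
theorem checkSquareFree_of_mem : ∀ e ∈ squareFreeCodes, checkSquareFree e.1 e.2 = true := by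
  decide +kernel

set_option maxRecDepth 10000 in
theorem map_fst_extremalCodes : extremalCodes.map Prod.fst =
    [4, 6, 8, 13, 15, 16, 18, 20, 21, 22, 23, 24, 28, 30, 32, 33, 34, 35, 36] ++
      List.range' 38 112 := by
  decide +kernel

theorem exists_extremalSquareFree_of_mem {n : ℕ} (h : n ∈ extremalCodes.map Prod.fst) :
    ∃ w : List (Fin 3), w.length = n ∧ ExtremalSquareFree (w : Cycle (Fin 3)) := by
  have hn : 0 < n := by
    rw [map_fst_extremalCodes, List.mem_append, List.mem_range'_1] at h
    rcases h with h | h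
    · revert n; decide
    · omega
  obtain ⟨⟨n, v⟩, he, rfl⟩ := List.mem_map.1 h
  exact ⟨_, length_decode n v, extremalSquareFree_of_checkExtremal hn (checkExtremal_of_mem _ he)⟩

theorem exists_circularSquareFree_of_mem {n : ℕ} (h : n ∈ squareFreeCodes.map Prod.fst) :
    ∃ w : List (Fin 3), w.length = n ∧ CircularSquareFree (w : Cycle (Fin 3)) := by
  obtain ⟨⟨n, v⟩, he, rfl⟩ := List.mem_map.1 h
  exact ⟨_, length_decode n v, circularSquareFree_of_checkSquareFree (checkSquareFree_of_mem _ he)⟩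


/-! ### Lengths reached by substitution -/

/-- The lengths of the words that can be substituted for the letter `2`. -/
def blockLengths : List ℕ := (blocks 2).map List.length

theorem exists_mem_blocks_length (c : Fin 3) : ∃ b ∈ blocks c, b.length = 43 := by
  revert c; decide +kernel

/-- The lengths of the words substituted for the first occurrences of the letter `2` can be
prescribed. -/
theorem exists_forall₂_blocks (us : List (Fin 3)) (q : List ℕ) (hq : ∀ x ∈ q, x ∈ blockLengths)
    (hc : q.length ≤ us.count 2) :
    ∃ bs, List.Forall₂ (fun c b => b ∈ {b | b ∈ blocks c}) us bs ∧
      bs.flatten.length + 43 * q.length = 43 * us.length + q.sum := by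
  induction us generalizing q with
  | nil =>
    obtain rfl : q = [] := by simpa using hc
    exact ⟨[], .nil, by simp⟩
  | cons c us ih =>
    obtain ⟨b, hb, hb'⟩ := exists_mem_blocks_length c
    -- The prescribed lengths are spent as late as possible: while the remaining letters contain
    -- enough 2s, the default length 43 is used. Otherwise the current letter must be a 2.
    by_cases h : q.length ≤ us.count 2
    · obtain ⟨bs, h1, h2⟩ := ih q hq h
      refine ⟨b :: bs, .cons hb h1, ?_⟩
      simp only [List.flatten_cons, List.length_append, List.length_cons]
      omega
    · match q with
      | [] => simp at h
      | x :: q =>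
        have hc2 : c = 2 := by
          by_contra hne
          rw [List.count_cons_of_ne hne] at hc
          exact h hc
        subst hc2
        rw [List.count_cons_self, List.length_cons] at hc
        obtain ⟨bs, h1, h2⟩ := ih q (fun y hy => hq y (List.mem_cons_of_mem _ hy)) (by omega)
        obtain ⟨b', hb1, hb2⟩ := List.mem_map.1 (hq x List.mem_cons_self)
        refine ⟨b' :: bs, .cons hb1 h1, ?_⟩
        simp only [List.flatten_cons, List.length_append, List.length_cons, List.sum_cons]
        omega

theorem exists_extremalSquareFree_of_circularSquareFree {us : List (Fin 3)} {q : List ℕ} {n : ℕ}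
    (hus : CircularSquareFree (us : Cycle (Fin 3))) (hl : 2 ≤ us.length)
    (hq : ∀ x ∈ q, x ∈ blockLengths) (hc : q.length ≤ us.count 2)
    (hn : n + 43 * q.length = 43 * us.length + q.sum) :
    ∃ w : List (Fin 3), w.length = n ∧ ExtremalSquareFree (w : Cycle (Fin 3)) := by
  obtain ⟨bs, h1, h2⟩ := exists_forall₂_blocks us q hq hc
  exact ⟨bs.flatten, by omega,
    extremalSquareFree_flatten markedCode_blocks closedGaps_blocks h1 hl hus⟩

theorem exists_two_blockLengths {t : ℕ} (h1 : 64 ≤ t) (h2 : t ≤ 150) :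
    ∃ x ∈ blockLengths, ∃ y ∈ blockLengths, x + y = t := by
  have : ∀ s < 87, ∃ x ∈ blockLengths, ∃ y ∈ blockLengths, x + y = 64 + s := by decide +kernel
  have h3 := this (t - 64) (by omega)
  rwa [Nat.add_sub_cancel' h1] at h3

theorem exists_three_blockLengths {t : ℕ} (h1 : 90 ≤ t) (h2 : t ≤ 225) :
    ∃ x ∈ blockLengths, ∃ y ∈ blockLengths, ∃ z ∈ blockLengths, x + y + z = t := by
  have h26 : 26 ∈ blockLengths := by decide +kernel
  have h75 : 75 ∈ blockLengths := by decide +kernel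
  rcases le_or_gt t 176 with h | h
  -- With third length 26 the sums fill 90 to 176, with 75 they fill 139 to 225.
  · obtain ⟨x, hx, y, hy, e⟩ := exists_two_blockLengths (t := t - 26) (by omega) (by omega)
    exact ⟨x, hx, y, hy, 26, h26, by omega⟩
  · obtain ⟨x, hx, y, hy, e⟩ := exists_two_blockLengths (t := t - 75) (by omega) (by omega)
    exact ⟨x, hx, y, hy, 75, h75, by omega⟩

theorem count_add_count_add_count (w : List (Fin 3)) :
    w.count 0 + w.count 1 + w.count 2 = w.length := by
  induction w with
  | nil => rfl
  | cons a w ih =>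
    rw [List.length_cons, ← ih]
    fin_cases a <;> simp <;> omega

/-- By pigeonhole some letter occurs three times; swapping it with 2 preserves square-freeness. -/
theorem exists_three_le_count {k : ℕ} (hk : 8 ≤ k)
    (h : ∃ w : List (Fin 3), w.length = k ∧ CircularSquareFree (w : Cycle (Fin 3))) :
    ∃ w : List (Fin 3), w.length = k ∧ CircularSquareFree (w : Cycle (Fin 3)) ∧
      3 ≤ w.count 2 := by
  obtain ⟨w, hw, hsq⟩ := h
  have h1 := count_add_count_add_count w
  obtain ⟨c, hc⟩ : ∃ c, 3 ≤ w.count c := by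
    by_contra! hcon
    have h2 := hcon 0
    have h3 := hcon 1
    have h4 := hcon 2
    omega
  refine ⟨w.map (Equiv.swap c 2), by simpa using hw,
    (circularSquareFree_map_iff (Equiv.injective _) w).2 hsq, ?_⟩
  have := List.count_map_of_injective w _ (Equiv.swap c 2).injective c
  rw [Equiv.swap_apply_left] at this
  rwa [this]

/-- Three blocks of length 43 are replaced by blocks of total length 90 to 225, which gives the
range from 43k - 129 + 90 to 43k - 129 + 225. -/
theorem exists_extremalSquareFree_of_three_le {k n : ℕ} (hk : 8 ≤ k)
    (h : ∃ w : List (Fin 3), w.length = k ∧ CircularSquareFree (w : Cycle (Fin 3)))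
    (h1 : 43 * k ≤ n + 39) (h2 : n ≤ 43 * k + 96) :
    ∃ w : List (Fin 3), w.length = n ∧ ExtremalSquareFree (w : Cycle (Fin 3)) := by
  obtain ⟨us, hus, hsq, hc⟩ := exists_three_le_count hk h
  obtain ⟨x, hx, y, hy, z, hz, e⟩ :=
    exists_three_blockLengths (t := n + 129 - 43 * k) (by omega) (by omega)
  refine exists_extremalSquareFree_of_circularSquareFree (q := [x, y, z]) hsq (by omega) ?_ hc ?_
  · simp [hx, hy, hz]
  · simp only [List.length_cons, List.length_nil, List.sum_cons, List.sum_nil]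
    omega

theorem exists_extremalSquareFree_of_two {us : List (Fin 3)} {n : ℕ}
    (hsq : circularNoSquares (us.length / 2) us.length (code us) = true) (hl : 2 ≤ us.length)
    (hc : 2 ≤ us.count 2) (h1 : 43 * us.length ≤ n + 22) (h2 : n ≤ 43 * us.length + 64) :
    ∃ w : List (Fin 3), w.length = n ∧ ExtremalSquareFree (w : Cycle (Fin 3)) := by
  obtain ⟨x, hx, y, hy, e⟩ :=
    exists_two_blockLengths (t := n + 86 - 43 * us.length) (by omega) (by omega)
  refine exists_extremalSquareFree_of_circularSquareFree (q := [x, y])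
    ((circularNoSquares_half_iff us).1 hsq) hl ?_ hc ?_
  · simp [hx, hy]
  · simp only [List.length_cons, List.length_nil, List.sum_cons, List.sum_nil]
    omega

theorem exists_circularSquareFree_of_lt {k : ℕ} (hk : k < 150)
    (h : k ∈ [8, 11, 13, 15, 16] ∨ 18 ≤ k) :
    ∃ w : List (Fin 3), w.length = k ∧ CircularSquareFree (w : Cycle (Fin 3)) := by
  have : ∀ k < 150, (k ∈ [8, 11, 13, 15, 16] ∨ 18 ≤ k) →
      k ∈ extremalCodes.map Prod.fst ∨ k ∈ squareFreeCodes.map Prod.fst := by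
    rw [map_fst_extremalCodes]
    decide +kernel
  rcases this k hk h with h | h
  · obtain ⟨w, h1, h2⟩ := exists_extremalSquareFree_of_mem h
    exact ⟨w, h1, h2.1⟩
  · exact exists_circularSquareFree_of_mem h

/-- Class words of lengths 4, 6, 8, 11, 13, 15 and 16 cover 150 to 784 by overlapping intervals.
Beyond that a class word of length at least 18 is needed, and `ih` provides it. -/
theorem exists_extremalSquareFree_of_ge {n : ℕ} (hn : 150 ≤ n)
    (ih : ∀ k, 18 ≤ k → k < n →
      ∃ w : List (Fin 3), w.length = k ∧ CircularSquareFree (w : Cycle (Fin 3))) :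
    ∃ w : List (Fin 3), w.length = n ∧ ExtremalSquareFree (w : Cycle (Fin 3)) := by
  have small : ∀ k ∈ [8, 11, 13, 15, 16],
      ∃ w : List (Fin 3), w.length = k ∧ CircularSquareFree (w : Cycle (Fin 3)) := fun k hk =>
    exists_circularSquareFree_of_lt (by revert k; decide) (Or.inl hk)
  by_cases h1 : n ≤ 236
  · exact exists_extremalSquareFree_of_two (us := [2, 0, 2, 1]) (by decide +kernel) (by decide)
      (by decide) (by simp; omega) (by simp; omega)
  by_cases h2 : n ≤ 322
  · exact exists_extremalSquareFree_of_two (us := [2, 0, 2, 1, 0, 1]) (by decide +kernel)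
      (by decide) (by decide) (by simp; omega) (by simp; omega)
  by_cases h3 : n ≤ 440
  · exact exists_extremalSquareFree_of_three_le (k := 8) (by omega) (small _ (by decide))
      (by omega) (by omega)
  by_cases h4 : n ≤ 569
  · exact exists_extremalSquareFree_of_three_le (k := 11) (by omega) (small _ (by decide))
      (by omega) (by omega)
  by_cases h5 : n ≤ 655
  · exact exists_extremalSquareFree_of_three_le (k := 13) (by omega) (small _ (by decide))
      (by omega) (by omega)
  by_cases h6 : n ≤ 741
  · exact exists_extremalSquareFree_of_three_le (k := 15) (by omega) (small _ (by decide))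
      (by omega) (by omega)
  by_cases h7 : n ≤ 784
  · exact exists_extremalSquareFree_of_three_le (k := 16) (by omega) (small _ (by decide))
      (by omega) (by omega)
  -- Here 43k lies between n - 13 and n + 29, well within the admissible range, and n ≥ 785 gives k
  -- ≥ 18.
  · exact exists_extremalSquareFree_of_three_le (k := (n - 100) / 43 + 3) (by omega)
      (ih _ (by omega) (by omega)) (by omega) (by omega)

/-- There are square-free circular words over three letters of all lengths from 18 on. -/
theorem exists_circularSquareFree {k : ℕ} (hk : 18 ≤ k) :
    ∃ w : List (Fin 3), w.length = k ∧ CircularSquareFree (w : Cycle (Fin 3)) := by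
  induction k using Nat.strong_induction_on with
  | _ k ih =>
    rcases lt_or_ge k 150 with h | h
    · exact exists_circularSquareFree_of_lt h (Or.inr hk)
    · obtain ⟨w, h1, h2⟩ := exists_extremalSquareFree_of_ge h fun m hm hmk => ih m hmk hm
      exact ⟨w, h1, h2.1⟩

/-! ### Nonexistence for the excluded lengths -/

theorem le_of_isExcluded {n : ℕ} (h : isExcluded n = true) : n ≤ 37 := by
  by_contra hn
  have h1 : 140358868652 >>> n = 0 := by
    rw [Nat.shiftRight_eq_div_pow]
    refine Nat.div_eq_of_lt (lt_of_lt_of_le (b := 2 ^ 38) (by norm_num) ?_)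
    exact Nat.pow_le_pow_right (by norm_num) (by omega)
  have h2 : Nat.beq (Nat.land (140358868652 >>> n) 1) 1 = true := h
  rw [h1] at h2
  exact absurd h2 (by decide)

-- At most 30 = 37 - 7 letters precede the pattern.
set_option maxRecDepth 10000 in
theorem search_pattern : search false 30 7 (code [2, 1, 2, 0, 2, 1, 0]) = true := by
  decide +kernel

-- At most 35 = 37 - 2 letters precede 01. The branches cut off at the pattern are those settled by
-- `search_pattern`.
set_option maxRecDepth 10000 in
theorem search_avoiding : search true 35 2 (code [0, 1]) = true := by decide +kernel

theorem not_extremalSquareFree_append_pattern (r : List (Fin 3))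
    (hr : isExcluded (r.length + 7) = true) :
    ¬ ExtremalSquareFree ((r ++ [2, 1, 2, 0, 2, 1, 0] : List (Fin 3)) : Cycle (Fin 3)) := by
  have h := le_of_isExcluded hr
  exact not_extremalSquareFree_of_search (l := [2, 1, 2, 0, 2, 1, 0]) (fun h => by cases h)
    search_pattern (by omega) hr

theorem exists_perm_of_pair : ∀ x y : Fin 3, x ≠ y →
    ∃ σ : Equiv.Perm (Fin 3), σ x = 0 ∧ σ y = 1 := by decide

/-- The last two letters differ, since equal ones would be a square; a letter permutation makes them
0 and 1, the root of the search. -/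
theorem not_extremalSquareFree_of_isExcluded {w : List (Fin 3)} (hw2 : 2 ≤ w.length)
    (hw : isExcluded w.length = true) : ¬ ExtremalSquareFree (w : Cycle (Fin 3)) := by
  intro hx
  obtain ⟨r, x, y, rfl⟩ : ∃ r x y, w = r ++ [x, y] := by
    rcases w.eq_nil_or_concat with rfl | ⟨w', y, rfl⟩
    · simp at hw2
    · rcases w'.eq_nil_or_concat with rfl | ⟨r, x, rfl⟩
      · simp at hw2
      · exact ⟨r, x, y, by simp⟩
  have hxy : x ≠ y := by
    rintro rfl
    exact hx.1 _ rfl [x] (by simp) ⟨r, [], by simp⟩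
  obtain ⟨σ, h0, h1⟩ := exists_perm_of_pair x y hxy
  have hx' := extremalSquareFree_map σ hx
  have e : (r ++ [x, y]).map σ = r.map σ ++ [0, 1] := by simp [h0, h1]
  have hlen : (r ++ [x, y]).length = (r.map σ).length + 2 := by simp
  rw [e] at hx'
  rw [hlen] at hw
  have h := le_of_isExcluded hw
  exact not_extremalSquareFree_of_search (l := [0, 1])
    (fun _ => not_extremalSquareFree_append_pattern) search_avoiding (by omega) hw hx'

theorem not_extremalSquareFree_of_length_le_one {w : List (Fin 3)} (hw : w.length ≤ 1) :
    ¬ ExtremalSquareFree (w : Cycle (Fin 3)) := by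
  match w, hw with
  | [], _ =>
    rw [extremalSquareFree_coe_iff]
    -- The empty word extends to a single letter, which is square-free.
    exact fun h => h.2 0 0 ((circularNoSquares_half_iff [0]).1 (by decide +kernel))
  | [a], _ =>
    refine not_extremalSquareFree_of_notExtremal ?_
    revert a
    decide +kernel

end CircularWords

theorem theorem3 (n : ℕ) :
    (∃ c : Cycle (Fin 3), c.length = n ∧ CircularWords.ExtremalSquareFree c) ↔
      n ∈ ({4, 6, 8, 13, 15, 16, 18, 20, 21, 22, 23, 24, 28, 30, 32, 33, 34, 35, 36} : Set ℕ) ∪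
        {m : ℕ | 38 ≤ m} := by
  constructor
  · rintro ⟨c, hc, hx⟩
    obtain ⟨w, rfl⟩ := Quot.exists_rep c
    have hw : w.length = n := hc
    by_contra hn
    rcases le_or_gt n 1 with h1 | h1
    · exact CircularWords.not_extremalSquareFree_of_length_le_one (by omega) hx
    · refine CircularWords.not_extremalSquareFree_of_isExcluded (by omega) ?_ hx
      rw [hw]
      have key : ∀ m < 38, 1 < m → m ∉ [4, 6, 8, 13, 15, 16, 18, 20, 21, 22, 23, 24, 28, 30, 32,
          33, 34, 35, 36] → CircularWords.isExcluded m = true := by decide +kernel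
      simp only [Set.mem_union, Set.mem_ofPred_eq, not_or] at hn
      exact key n (by omega) h1 fun h => hn.1 (by simpa using h)
  · intro hn
    have key : ∃ w : List (Fin 3), w.length = n ∧
        CircularWords.ExtremalSquareFree (w : Cycle (Fin 3)) := by
      rcases lt_or_ge n 150 with h | h
      · refine CircularWords.exists_extremalSquareFree_of_mem ?_
        rw [CircularWords.map_fst_extremalCodes, List.mem_append, List.mem_range'_1]
        rcases hn with hn | hn
        · left
          simpa using hn
        · right
          exact ⟨hn, by omega⟩
      · exact CircularWords.exists_extremalSquareFree_of_ge h fun k hk _ =>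
          CircularWords.exists_circularSquareFree hk
    obtain ⟨w, h1, h2⟩ := key
    exact ⟨w, by simpa using h1, h2⟩
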